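/- **Setting.** Fix $m\ge 1$. An instance of the online-list variant of $Qm||C_{\max}$ consists of $m$ machines with real speeds $s_1,\dots,s_m>0$ and a finite list of jobs with integral processing times $p_j\ge 1$; job $j$ takes time $p_j/s_i$ on machine $i$, and the makespan of an assignment of the jobs to the machines is the largest completion time $\max_i\frac1{s_i}\sum_{j\text{ assigned to }i}p_j$. A (deterministic) online algorithm knows the speeds; the jobs are revealed one by one, and each job has to be assigned irrevocably to a machine before the next one is revealed. An online algorithm $A$ is $\rho$-competitive if $A(I)\le\rho\cdot\mathrm{OPT}(I)$ for every instance $I$ with $m$ machines, where $A(I)$ is its makespan and $\mathrm{OPT}(I)$ the optimal offline makespan. Its competitive ratio $\rho_A(m)\in[0,\infty]$ is the infimum of all such $\rho$, and the optimal competitive ratio is $\rho^*(m)=\inf_A\rho_A(m)$ over all online algorithms $A$ for $m$ machines. **Theorem.** There is a competitive-ratio approximation scheme for the online-list variant of $Qm||C_{\max}$ for any number $m$ of uniformly related machines. That is, there is a single computable procedure that, given $m\ge 1$ and a rational $\varepsilon>0$, outputs a program $c$, a precision $d\in\mathbb N$ and a rational number $\rho'$ such that 1. given any positive rational numbers $q_1,\dots,q_m$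 and the list of the processing times of the jobs revealed so far, $c$ halts and outputs a machine for the newest job; 2. every online algorithm $A$ that is executed by $c$ has competitive ratio $\rho_A(m)\le(1+\varepsilon)\,\rho^*(m)$; here $A$ is executed by $c$ if for every speed vector $s$ there are positive rationals $q_i$ with $q_i\le s_i\le(1+2^{-d})q_i$ for all $i$ (for instance $q_i=s_i$ if the speeds are rational) such that, on speeds $s$, $A$ assigns each revealed job to the machine that $c$ outputs on $q$ and the jobs revealed so far; 3. $\rho'\le\rho^*(m)\le(1+\varepsilon)\,\rho'$. -/

import Mathlib

open scoped NNReal ENNReal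

noncomputable section

namespace RelatedMachines

/-- The makespan on `m` uniformly related machines with speeds `s` of the schedule in which the
`j`-th job of the list `l` of processing times is assigned to machine `σ j`: job `j` takes time
`l[j] / s i` on machine `i`. -/
def makespan {m : ℕ} (s : Fin m → ℝ) (l : List ℕ) (σ : Fin l.length → Fin m) : ℝ :=
  ⨆ i : Fin m, ∑ j with σ j = i, (l.get j : ℝ) / s i

/-- The optimal offline makespan. -/
def opt {m : ℕ} (s : Fin m → ℝ) (l : List ℕ) : ℝ :=
  ⨅ σ : Fin l.length → Fin m, makespan s l σ

/-- A (deterministic) online algorithm for `m` machines in the online-list model. It is told the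
speeds; when a job is revealed it knows the list of processing times of all jobs revealed so far
(the new job is the last entry of the list), and it names the machine that receives the new job.
The earlier assignments are determined by the algorithm and the earlier jobs. -/
abbrev OnlineAlg (m : ℕ) : Type := (Fin m → ℝ) → List ℕ → Fin m

/-- The assignment that the online algorithm produces when the jobs of `l` are revealed one by
one: job `j` is assigned knowing only the jobs `0, …, j`. -/
def OnlineAlg.assignment {m : ℕ} (A : OnlineAlg m) (s : Fin m → ℝ) (l : List ℕ) :
    Fin l.length → Fin m :=
  fun j => A s (l.take (j + 1))

/-- `A` is `ρ`-competitive: on every instance with `m` machines (positive real speeds and a finite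
list of jobs with integral processing times at least `1`) its makespan is at most `ρ` times the
optimal offline makespan. -/
def OnlineAlg.IsCompetitive {m : ℕ} (A : OnlineAlg m) (ρ : ℝ≥0) : Prop :=
  ∀ s : Fin m → ℝ, (∀ i, 0 < s i) → ∀ l : List ℕ, (∀ p ∈ l, 1 ≤ p) →
    makespan s l (A.assignment s l) ≤ ρ * opt s l

/-- The competitive ratio of `A`, the infimum of all `ρ` such that `A` is `ρ`-competitive
(`∞` if there is none). -/
def OnlineAlg.competitiveRatio {m : ℕ} (A : OnlineAlg m) : ℝ≥0∞ :=
  ⨅ (ρ : ℝ≥0) (_ : A.IsCompetitive ρ), (ρ : ℝ≥0∞)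

/-- The optimal competitive ratio `ρ*(m)` for `m` uniformly related machines. All online
algorithms compete here, computable or not. -/
def optimalRatio (m : ℕ) : ℝ≥0∞ :=
  ⨅ A : OnlineAlg m, A.competitiveRatio

/-- The nonnegative rational number `a / b` denoted by a pair `(a, b)`. -/
def frac (q : ℕ × ℕ) : ℝ≥0 := q.1 / q.2

/-- The program `c`, run on the rational speeds `q` and the list `l` of all jobs revealed so far,
halts and outputs (the number of) machine `i`. -/
def Outputs {m : ℕ} (c : Nat.Partrec.Code) (q : Fin m → ℕ × ℕ) (l : List ℕ) (i : Fin m) : Prop :=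
  (i : ℕ) ∈ c.eval (Encodable.encode (List.ofFn q, l))

/-- The positive rational numbers `q i` approximate the speeds `s i` with relative precision
`2⁻ᵈ`. -/
def Approximates {m : ℕ} (d : ℕ) (q : Fin m → ℕ × ℕ) (s : Fin m → ℝ) : Prop :=
  ∀ i, 0 < frac (q i) ∧ (frac (q i) : ℝ) ≤ s i ∧ s i ≤ (1 + (2 : ℝ)⁻¹ ^ d) * frac (q i)

/-- `A` is an online algorithm executed by the program `c`: for every vector of speeds, `c` is
given some rational approximation of the speeds with relative precision `2⁻ᵈ` (which may be the
speeds themselves if they are rational), and computes every decision of `A` from it. -/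
def Executes {m : ℕ} (c : Nat.Partrec.Code) (d : ℕ) (A : OnlineAlg m) : Prop :=
  ∀ s : Fin m → ℝ, (∀ i, 0 < s i) →
    ∃ q : Fin m → ℕ × ℕ, Approximates d q s ∧ ∀ l : List ℕ, Outputs c q l (A s l)

end RelatedMachines

end

/-! Call a position (the jobs so far and their loads) safe for a ratio if some online strategy can
keep that ratio forever. Whether the empty position is safe for `r` on all speeds decides, up to
equality, on which side of `r` the optimal ratio lies (`optimalRatio_le`, `le_optimalRatio`). The
point is to decide safety approximately.

Truncation (`safe_of_safeUpTo`): a strategy that is safe up to an explicit total size yields one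
that is safe forever with slightly larger ratio. Rescale a position to total size one and round both
its loads and the capacities into which its jobs can be packed. Only finitely many rounded states
exist, so by pigeonhole there is a size beyond which, for one more growth factor, no new state
appears (`exists_recurrent`). An unbounded instance is therefore simulated by a bounded play at a
variable scale: jobs are rounded to the scale, tiny jobs are collected in buckets, and when the play
has doubled it is replaced by a smaller play in the same rounded state (`Tracks.jump`). Doubling
makes old errors a geometric series, so the accumulated error stays proportional to the precision. A
job that dwarfs everything before it restarts the play (`tracks_giant`).

Strategies on a bounded game are finite tables and the optimum is a minimum over finitely many
assignments, so safety up to the horizon is a primitive recursive test. It accepts whenever the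
ratio can be kept forever, and acceptance guarantees a ratio larger by at most `1 + 1 / Z`
(`stepTest_of_safe`, `safe_of_stepTest`).

Slow machines can be simulated on the fastest one, so a finite grid of speeds suffices
(`safe_of_grid`). Searching for the first multiple of `1 / Z` accepted on the whole grid
approximates the optimal ratio from both sides. The program then puts each job on the first machine
whose resulting position passes the test; the slacks shrink so fast that the ratio grows by a
bounded factor in total (`run_safe`). -/

namespace RelatedMachines

/-! ### Loads of assignments and of online strategies. -/

section Loads

variable {ι : Type*} [DecidableEq ι]

/-- The total processing time on machine `i` if job `j` of `l` is assigned to machine `σ j`. -/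
def asgLoad (l : List ℕ) (σ : ℕ → ι) (i : ι) : ℕ :=
  ∑ j ∈ Finset.range l.length, if σ j = i then l.getD j 0 else 0

/-- The total processing time on machine `i` if the jobs of `l` are assigned online by `B`. -/
def stratLoad (B : List ℕ → ι) (l : List ℕ) (i : ι) : ℕ :=
  asgLoad l (fun j => B (l.take (j + 1))) i

theorem asgLoad_congr {l : List ℕ} {σ τ : ℕ → ι} (h : ∀ j < l.length, σ j = τ j) (i : ι) :
    asgLoad l σ i = asgLoad l τ i :=
  Finset.sum_congr rfl fun j hj => by rw [h j (Finset.mem_range.1 hj)]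

@[simp]
theorem asgLoad_nil (σ : ℕ → ι) (i : ι) : asgLoad [] σ i = 0 := by simp [asgLoad]

theorem asgLoad_append_singleton (l : List ℕ) (p : ℕ) (σ : ℕ → ι) (i : ι) :
    asgLoad (l ++ [p]) σ i = asgLoad l σ i + if σ l.length = i then p else 0 := by
  unfold asgLoad
  rw [List.length_append, List.length_singleton, Finset.sum_range_succ]
  congr 1
  · refine Finset.sum_congr rfl fun j hj => ?_
    rw [List.getD_append _ _ _ _ (Finset.mem_range.1 hj)]
  · simp

theorem asgLoad_cons (l : List ℕ) (p : ℕ) (σ : ℕ → ι) (i : ι) :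
    asgLoad (p :: l) σ i = (if σ 0 = i then p else 0) + asgLoad l (fun j => σ (j + 1)) i := by
  unfold asgLoad
  rw [List.length_cons, Finset.sum_range_succ', add_comm]
  simp

theorem sum_asgLoad [Fintype ι] (l : List ℕ) (σ : ℕ → ι) : ∑ i, asgLoad l σ i = l.sum := by
  induction l using List.reverseRecOn with
  | nil => simp
  | append_singleton l p ih =>
    simp [asgLoad_append_singleton, Finset.sum_add_distrib, ih]

theorem asgLoad_le_sum (l : List ℕ) (σ : ℕ → ι) (i : ι) : asgLoad l σ i ≤ l.sum := by
  induction l using List.reverseRecOn with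
  | nil => simp
  | append_singleton l p ih =>
    rw [asgLoad_append_singleton, List.sum_append, List.sum_singleton]
    split_ifs <;> omega

theorem asgLoad_comp_injective {κ : Type*} [DecidableEq κ] {g : ι → κ}
    (hg : Function.Injective g) (l : List ℕ) (σ : ℕ → ι) (i : ι) :
    asgLoad l (fun j => g (σ j)) (g i) = asgLoad l σ i := by
  simp [asgLoad, hg.eq_iff]

@[simp]
theorem stratLoad_nil (B : List ℕ → ι) (i : ι) : stratLoad B [] i = 0 := by simp [stratLoad]

theorem stratLoad_append_singleton (B : List ℕ → ι) (l : List ℕ) (p : ℕ) (i : ι) :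
    stratLoad B (l ++ [p]) i = stratLoad B l i + if B (l ++ [p]) = i then p else 0 := by
  unfold stratLoad
  rw [asgLoad_append_singleton]
  congr 1
  · refine asgLoad_congr (fun j hj => ?_) i
    rw [List.take_append_of_le_length (by omega)]
  · rw [List.take_of_length_le (by simp)]

theorem stratLoad_cons (B : List ℕ → ι) (l : List ℕ) (p : ℕ) (i : ι) :
    stratLoad B (p :: l) i =
      (if B [p] = i then p else 0) + stratLoad (fun f => B (p :: f)) l i := by
  unfold stratLoad
  rw [asgLoad_cons]
  simp

theorem stratLoad_le_sum (B : List ℕ → ι) (l : List ℕ) (i : ι) : stratLoad B l i ≤ l.sum :=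
  asgLoad_le_sum _ _ _

end Loads

variable {m : ℕ}

/-- `w` is the vector of total processing times of some assignment of the jobs of `l`. -/
def IsLoad (l : List ℕ) (w : Fin m → ℕ) : Prop :=
  ∃ σ : ℕ → Fin m, ∀ i, w i = asgLoad l σ i

theorem IsLoad.sum_eq {l : List ℕ} {w : Fin m → ℕ} (h : IsLoad l w) : ∑ i, w i = l.sum := by
  obtain ⟨σ, hσ⟩ := h
  simp only [hσ, sum_asgLoad]

theorem IsLoad.le_sum {l : List ℕ} {w : Fin m → ℕ} (h : IsLoad l w) (i : Fin m) :
    w i ≤ l.sum := by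
  obtain ⟨σ, hσ⟩ := h
  exact hσ i ▸ asgLoad_le_sum _ _ _

theorem exists_isLoad [NeZero m] (l : List ℕ) : ∃ w : Fin m → ℕ, IsLoad l w :=
  ⟨_, fun _ => 0, fun _ => rfl⟩

theorem isLoad_append_singleton {l : List ℕ} {p : ℕ} {w : Fin m → ℕ} :
    IsLoad (l ++ [p]) w ↔
      ∃ (i : Fin m) (u : Fin m → ℕ), IsLoad l u ∧ ∀ k, w k = u k + if i = k then p else 0 := by
  constructor
  · rintro ⟨σ, hσ⟩
    exact ⟨σ l.length, _, ⟨σ, fun _ => rfl⟩, fun k => by rw [hσ, asgLoad_append_singleton]⟩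
  · rintro ⟨i, u, ⟨σ, hσ⟩, hw⟩
    refine ⟨fun j => if j < l.length then σ j else i, fun k => ?_⟩
    rw [hw, asgLoad_append_singleton, hσ]
    congr 1
    · exact asgLoad_congr (fun j hj => by simp [hj]) k
    · simp

theorem IsLoad.append_singleton {l : List ℕ} {u : Fin m → ℕ} (h : IsLoad l u) (p : ℕ)
    (i : Fin m) : IsLoad (l ++ [p]) (fun k => u k + if i = k then p else 0) :=
  isLoad_append_singleton.2 ⟨i, u, h, fun _ => rfl⟩

/-! ### The offline optimum expressed through load vectors. -/

section Opt

variable {s : Fin m → ℝ}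

theorem makespan_eq (s : Fin m → ℝ) (l : List ℕ) (σ : ℕ → Fin m) :
    makespan s l (fun j => σ j) = ⨆ i, (asgLoad l σ i : ℝ) / s i := by
  unfold makespan
  congr 1
  ext i
  rw [← Finset.sum_div, asgLoad, Finset.sum_filter, Nat.cast_sum,
    ← Fin.sum_univ_eq_sum_range (fun j => ((if σ j = i then l.getD j 0 else 0 : ℕ) : ℝ))]
  congr 1
  refine Finset.sum_congr rfl fun j _ => ?_
  split_ifs <;> simp

theorem makespan_nonneg (hs : ∀ i, 0 < s i) (l : List ℕ) (σ : Fin l.length → Fin m) :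
    0 ≤ makespan s l σ :=
  Real.iSup_nonneg fun i => Finset.sum_nonneg fun _ _ => div_nonneg (Nat.cast_nonneg _) (hs i).le

theorem opt_nonneg (hs : ∀ i, 0 < s i) (l : List ℕ) : 0 ≤ opt s l :=
  Real.iInf_nonneg fun σ => makespan_nonneg hs l σ

theorem opt_le_makespan (s : Fin m → ℝ) (l : List ℕ) (σ : Fin l.length → Fin m) :
    opt s l ≤ makespan s l σ :=
  ciInf_le (Set.finite_range _).bddBelow σ

variable [NeZero m]

theorem makespan_le_iff (hs : ∀ i, 0 < s i) (l : List ℕ) (σ : ℕ → Fin m) (c : ℝ) :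
    makespan s l (fun j => σ j) ≤ c ↔ ∀ i, (asgLoad l σ i : ℝ) ≤ c * s i := by
  rw [makespan_eq, ciSup_le_iff (Set.finite_range _).bddAbove]
  exact forall_congr' fun i => div_le_iff₀ (hs i)

theorem exists_extension (l : List ℕ) (σ : Fin l.length → Fin m) :
    ∃ τ : ℕ → Fin m, σ = fun j : Fin l.length => τ j :=
  ⟨fun j => if h : j < l.length then σ ⟨j, h⟩ else 0, by ext j; simp⟩

theorem opt_le (hs : ∀ i, 0 < s i) {l : List ℕ} {w : Fin m → ℕ} (hw : IsLoad l w) {c : ℝ}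
    (h : ∀ i, (w i : ℝ) ≤ c * s i) : opt s l ≤ c := by
  obtain ⟨σ, hσ⟩ := hw
  refine (opt_le_makespan s l fun j => σ j).trans ((makespan_le_iff hs l σ c).2 fun i => ?_)
  rw [← hσ]; exact h i

theorem exists_isLoad_le_opt (hs : ∀ i, 0 < s i) (l : List ℕ) :
    ∃ w : Fin m → ℕ, IsLoad l w ∧ ∀ i, (w i : ℝ) ≤ opt s l * s i := by
  obtain ⟨σ, hσ⟩ := exists_eq_ciInf_of_finite (f := fun σ => makespan s l σ)
  obtain ⟨τ, rfl⟩ := exists_extension l σ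
  exact ⟨_, ⟨τ, fun _ => rfl⟩, (makespan_le_iff hs l τ _).1 hσ.le⟩

/-- The minimum over assignments is attained. This form replaces the real number `opt` by finite
quantifiers, which is what makes the ratio test decidable later. -/
theorem le_opt_iff (hs : ∀ i, 0 < s i) (l : List ℕ) {c : ℝ} :
    c ≤ opt s l ↔ ∀ w : Fin m → ℕ, IsLoad l w → ∃ i, c * s i ≤ w i := by
  constructor
  · intro h w hw
    by_contra! hlt
    have : ∀ i, (w i : ℝ) / s i < c := fun i => (div_lt_iff₀ (hs i)).2 (hlt i)
    obtain ⟨i, -, hi⟩ := Finset.exists_max_image Finset.univ (fun i => (w i : ℝ) / s i) ⟨0, by simp⟩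
    have := opt_le hs hw (c := w i / s i) fun k => (div_le_iff₀ (hs k)).1 (hi k (by simp))
    linarith [‹∀ i, (w i : ℝ) / s i < c› i]
  · intro h
    obtain ⟨w, hw, hle⟩ := exists_isLoad_le_opt hs l
    obtain ⟨i, hi⟩ := h w hw
    exact le_of_mul_le_mul_right (hi.trans (hle i)) (hs i)

theorem sum_le_mul_opt (hs : ∀ i, 0 < s i) (l : List ℕ) :
    (l.sum : ℝ) ≤ (∑ i, s i) * opt s l := by
  obtain ⟨w, hw, hle⟩ := exists_isLoad_le_opt hs l
  rw [← hw.sum_eq, Nat.cast_sum, Finset.sum_mul]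
  exact Finset.sum_le_sum fun i _ => by rw [mul_comm]; exact hle i

theorem makespan_assignment_le_iff (hs : ∀ i, 0 < s i) (A : OnlineAlg m) (l : List ℕ) (c : ℝ) :
    makespan s l (A.assignment s l) ≤ c ↔ ∀ i, (stratLoad (A s) l i : ℝ) ≤ c * s i :=
  makespan_le_iff hs l (fun j => A s (l.take (j + 1))) c

end Opt

/-! ### Safe positions. -/

/-- After the jobs `l`, which put the loads `w` on the machines, some online algorithm can keep
the makespan below `r` times the optimum for all continuations up to total size `N`. -/
def SafeUpTo (N : ℕ∞) (q : Fin m → ℝ) (r : ℝ) (l : List ℕ) (w : Fin m → ℕ) : Prop :=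
  ∃ B : List ℕ → Fin m, ∀ f : List ℕ, (∀ p ∈ f, 1 ≤ p) → ((l.sum + f.sum : ℕ) : ℕ∞) ≤ N →
    ∀ i, ((w i + stratLoad B f i : ℕ) : ℝ) ≤ r * opt q (l ++ f) * q i

/-- After the jobs `l`, which put the loads `w` on the machines, some online algorithm can keep
the makespan below `r` times the optimum forever. -/
abbrev Safe (q : Fin m → ℝ) (r : ℝ) (l : List ℕ) (w : Fin m → ℕ) : Prop :=
  SafeUpTo ⊤ q r l w

theorem SafeUpTo.mono_ratio [NeZero m] {N : ℕ∞} {q : Fin m → ℝ} (hq : ∀ i, 0 < q i) {r r' : ℝ}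
    (h : r ≤ r') {l : List ℕ} {w : Fin m → ℕ} (hs : SafeUpTo N q r l w) :
    SafeUpTo N q r' l w := by
  obtain ⟨B, hB⟩ := hs
  refine ⟨B, fun f hf hN i => (hB f hf hN i).trans ?_⟩
  have := opt_nonneg hq (l ++ f)
  have := (hq i).le
  gcongr

theorem Safe.le {q : Fin m → ℝ} {r : ℝ} {l : List ℕ} {w : Fin m → ℕ} (hs : Safe q r l w)
    (i : Fin m) : (w i : ℝ) ≤ r * opt q l * q i := by
  obtain ⟨B, hB⟩ := hs
  simpa using hB [] (by simp) le_top i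

theorem Safe.step {q : Fin m → ℝ} {r : ℝ} {l : List ℕ} {w : Fin m → ℕ} (hs : Safe q r l w)
    {p : ℕ} (hp : 1 ≤ p) :
    ∃ i, Safe q r (l ++ [p]) (fun k => w k + if i = k then p else 0) := by
  obtain ⟨B, hB⟩ := hs
  refine ⟨B [p], fun f => B (p :: f), fun f hf _ k => ?_⟩
  have := hB (p :: f) (by simpa [hp] using hf) le_top k
  rw [stratLoad_cons, ← add_assoc] at this
  simpa using this

/-- The loads that arise when every new job goes to a machine that preserves the invariant `P`. -/
noncomputable def invLoad [NeZero m] (P : List ℕ → (Fin m → ℕ) → Prop) (l : List ℕ)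
    (w : Fin m → ℕ) : List ℕ → Fin m → ℕ
  | [] => w
  | p :: f => fun k => invLoad P l w f k +
      if (Classical.epsilon fun i : Fin m => P (l ++ (f.reverse ++ [p]))
        fun k => invLoad P l w f k + if i = k then p else 0) = k then p else 0

/-- A property of positions that bounds the ratio and can be preserved for each next job gives a
strategy by choosing a preserving machine each time. The simulation can thus be described by an
invariant alone, without writing its strategy down. -/
theorem safe_of_invariant [NeZero m] {q : Fin m → ℝ} {r : ℝ} (P : List ℕ → (Fin m → ℕ) → Prop)
    (hP : ∀ l w, P l w → ∀ i, (w i : ℝ) ≤ r * opt q l * q i)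
    (hstep : ∀ l w, P l w → ∀ p, 1 ≤ p →
      ∃ i, P (l ++ [p]) (fun k => w k + if i = k then p else 0))
    {l : List ℕ} {w : Fin m → ℕ} (h : P l w) : Safe q r l w := by
  -- `invLoad` recurses on the reversed list, so its head is the newest job.
  let B : List ℕ → Fin m := fun f => Classical.epsilon fun i : Fin m => P (l ++ f)
    fun k => invLoad P l w f.reverse.tail k + if i = k then f.reverse.headI else 0
  have hload : ∀ f : List ℕ, (fun k => w k + stratLoad B f k) = invLoad P l w f.reverse := by
    intro f
    induction f using List.reverseRecOn with
    | nil => simp [invLoad]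
    | append_singleton f p ih =>
      funext k
      rw [stratLoad_append_singleton, ← add_assoc, congrFun ih k]
      simp [B, invLoad]
  have hinv : ∀ f : List ℕ, (∀ p ∈ f, 1 ≤ p) → P (l ++ f) (invLoad P l w f.reverse) := by
    intro f
    induction f using List.reverseRecOn with
    | nil => intro _; simpa [invLoad] using h
    | append_singleton f p ih =>
      intro hf
      have h1 := ih fun p hp => hf p (by simp [hp])
      have h2 := Classical.epsilon_spec (hstep _ _ h1 p (hf p (by simp)))
      simp only [List.reverse_append, List.reverse_cons, List.reverse_nil, List.nil_append,
        List.singleton_append, invLoad, List.reverse_reverse]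
      simpa only [List.append_assoc] using h2
  refine ⟨B, fun f hf _ i => ?_⟩
  rw [congrFun (hload f) i]
  exact hP _ _ (hinv f hf) i

/-! ### Simulation of an instance by a play at a variable scale. -/

/-- The play `f` of a bounded game, which continues the jobs `l₀` and the loads `w₀` according to
the strategy `B`, simulates at scale `lam` and with relative precision `η` the jobs `l` with the
loads `L`. Jobs much smaller than `lam * β` are collected in a bucket of size `lam * β` on machine
`μ`, which holds jobs of total size `o`. -/
structure Tracks (η : ℝ) (B : List ℕ → Fin m) (l₀ : List ℕ) (w₀ : Fin m → ℕ) (T₀ β : ℕ)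
    (f : List ℕ) (lam o : ℝ) (μ : Fin m) (l : List ℕ) (L : Fin m → ℕ) : Prop where
  pos : ∀ p ∈ f, 1 ≤ p
  lam_pos : 0 < lam
  le_sum : T₀ ≤ l₀.sum + f.sum
  bucket_le : (β : ℝ) ≤ η * T₀
  le_bucket : 2 ≤ η * (η * β)
  fill_nonneg : 0 ≤ o
  fill_le : o ≤ (1 + η) * (lam * β)
  load : ∀ i, L i + (if μ = i then (1 + η) * (lam * β) - o else 0) ≤
    (1 + η) * (lam * (w₀ i + stratLoad B f i)) + 4 * η * (lam * T₀)
  dom : ∀ u : Fin m → ℕ, IsLoad l u → ∃ u' : Fin m → ℕ, IsLoad (l₀ ++ f) u' ∧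
    ∀ i, lam * u' i ≤ u i + 4 * η * (lam * T₀) + 2 * (lam * β)
  volume : lam * (l₀.sum + f.sum) + o ≤
    l.sum + 4 * m * η * (lam * T₀) + (1 + η) * (lam * β)

namespace Tracks

variable {η : ℝ} {B : List ℕ → Fin m} {l₀ : List ℕ} {w₀ : Fin m → ℕ} {T₀ β : ℕ} {f : List ℕ}
  {lam o : ℝ} {μ : Fin m} {l : List ℕ} {L : Fin m → ℕ}

theorem bucket_pos (h : Tracks η B l₀ w₀ T₀ β f lam o μ l L) : 1 ≤ β := by
  by_contra hβ
  obtain rfl : β = 0 := by omega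
  have := h.le_bucket
  norm_num at this

/-- The play has already paid for the whole bucket, so the load bound reserves its free room on `μ`;
a tiny job only converts reserved room into load, and the play does not move. -/
theorem fill_bucket (h : Tracks η B l₀ w₀ T₀ β f lam o μ l L) {y : ℕ}
    (hy : (y : ℝ) < η * (lam * β)) (ho : o < lam * β) :
    Tracks η B l₀ w₀ T₀ β f lam (o + y) μ (l ++ [y]) (fun k => L k + if μ = k then y else 0) where
  pos := h.pos
  lam_pos := h.lam_pos
  le_sum := h.le_sum
  bucket_le := h.bucket_le
  le_bucket := h.le_bucket
  fill_nonneg := add_nonneg h.fill_nonneg (Nat.cast_nonneg _)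
  fill_le := by linarith
  load i := by
    have := h.load i
    split_ifs at this ⊢ <;> push_cast [-Nat.cast_list_sum] <;> linarith
  dom u hu := by
    obtain ⟨i, u₁, hu₁, hu⟩ := isLoad_append_singleton.1 hu
    obtain ⟨u', hu', hle⟩ := h.dom u₁ hu₁
    refine ⟨u', hu', fun k => (hle k).trans ?_⟩
    have : (u₁ k : ℝ) ≤ u k := by rw [hu k]; exact_mod_cast Nat.le_add_right _ _
    linarith
  volume := by
    have := h.volume
    rw [List.sum_append, List.sum_singleton]
    push_cast [-Nat.cast_list_sum]
    linarith

/-- A full bucket holds real jobs of volume at least `lam * β`, so the play may receive one more job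
of size `β`, placed by `B`. The offline side needs room for this job: this is what the invariant
`volume` is for. -/
theorem open_bucket (h : Tracks η B l₀ w₀ T₀ β f lam o μ l L) (hη : 0 < η) (hη1 : η ≤ 1)
    (ho : lam * β ≤ o) :
    Tracks η B l₀ w₀ T₀ β (f ++ [β]) lam 0 (B (f ++ [β])) l L where
  pos p hp := by
    rcases List.mem_append.1 hp with hp | hp
    · exact h.pos p hp
    · rw [List.mem_singleton.1 hp]; exact h.bucket_pos
  lam_pos := h.lam_pos
  le_sum := h.le_sum.trans (by simp)
  bucket_le := h.bucket_le
  le_bucket := h.le_bucket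
  fill_nonneg := le_rfl
  fill_le := by have := h.lam_pos; positivity
  load i := by
    have h1 := h.load i
    have h2 := h.fill_le
    rw [stratLoad_append_singleton]
    push_cast [-Nat.cast_list_sum]
    split_ifs at h1 ⊢ <;> linarith
  dom u hu := by
    obtain ⟨u', hu', hle⟩ := h.dom u hu
    have hlb : 0 ≤ lam * β := mul_nonneg h.lam_pos.le (Nat.cast_nonneg _)
    -- Averaging over the machines: if all exceeded this bound, the total would contradict `volume`.
    -- Adding `β` to machine `i` then costs at most `(1 + η) * (lam * β)`, within the allowed `2 *
    -- (lam * β)`.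
    obtain ⟨i, hi⟩ : ∃ i, lam * u' i ≤ u i + 4 * η * (lam * T₀) + η * (lam * β) := by
      by_contra! hlt
      have hsum : ∑ i, (u i + 4 * η * (lam * T₀)) + η * (lam * β) < ∑ i, lam * u' i := by
        have : Nonempty (Fin m) := ⟨μ⟩
        calc _ ≤ ∑ i, (u i + 4 * η * (lam * T₀) + η * (lam * β)) := by
              rw [Finset.sum_add_distrib (g := fun _ => η * (lam * β))]
              gcongr
              refine Finset.single_le_sum (f := fun _ => η * (lam * β)) (fun _ _ => ?_)
                (Finset.mem_univ μ)
              positivity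
          _ < _ := Finset.sum_lt_sum_of_nonempty Finset.univ_nonempty fun i _ => hlt i
      rw [← Finset.mul_sum, Finset.sum_add_distrib, ← Nat.cast_sum, ← Nat.cast_sum, hu.sum_eq,
        hu'.sum_eq, List.sum_append, Finset.sum_const, Finset.card_univ, Fintype.card_fin,
        nsmul_eq_mul] at hsum
      have := h.volume
      push_cast [-Nat.cast_list_sum] at hsum
      nlinarith
    refine ⟨_, List.append_assoc l₀ f [β] ▸ hu'.append_singleton β i, fun k => ?_⟩
    split_ifs with hk
    · subst hk
      push_cast [-Nat.cast_list_sum]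
      nlinarith
    · simpa using hle k
  volume := by
    have := h.volume
    rw [List.sum_append, List.sum_singleton]
    push_cast [-Nat.cast_list_sum]
    linarith

theorem small_step (h : Tracks η B l₀ w₀ T₀ β f lam o μ l L) (hη : 0 < η) (hη1 : η ≤ 1) {y : ℕ}
    (hy : (y : ℝ) < η * (lam * β)) :
    ∃ f' o' i, f'.sum ≤ f.sum + β ∧
      Tracks η B l₀ w₀ T₀ β f' lam o' i (l ++ [y]) (fun k => L k + if i = k then y else 0) := by
  rcases lt_or_ge o (lam * β) with ho | ho
  · exact ⟨f, _, μ, Nat.le_add_right _ _, h.fill_bucket hy ho⟩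
  · refine ⟨f ++ [β], _, _, by simp, (h.open_bucket hη hη1 ho).fill_bucket hy ?_⟩
    exact mul_pos h.lam_pos (Nat.cast_pos.2 (h.bucket_pos))

/-- The scaled size is at least `η * β`, and `η * (η * β) ≥ 2`, so rounding it down to an integer
loses at most the factor `1 + η`. Rounding down keeps the offline comparison valid; the factor is
charged to the loads. -/
theorem big_step (h : Tracks η B l₀ w₀ T₀ β f lam o μ l L) (hη : 0 < η) (hη1 : η ≤ 1) {y : ℕ}
    (hy : η * (lam * β) ≤ y) :
    ∃ i, Tracks η B l₀ w₀ T₀ β (f ++ [⌊y / lam⌋₊]) lam o μ (l ++ [y])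
      (fun k => L k + if i = k then y else 0) := by
  have hl := h.lam_pos
  have h1 : η * β ≤ y / lam := by rw [le_div_iff₀ hl]; linarith
  have h2 : y / lam < ⌊y / lam⌋₊ + 1 := Nat.lt_floor_add_one _
  have h3 : (⌊y / lam⌋₊ : ℝ) ≤ y / lam := Nat.floor_le (by positivity)
  have h4 : lam * (y / lam) = y := by field_simp
  have h5 : y / lam ≤ (1 + η) * ⌊y / lam⌋₊ := by nlinarith [h.le_bucket]
  have h6 : (y : ℝ) ≤ (1 + η) * (lam * ⌊y / lam⌋₊) := by nlinarith
  have h7 : lam * ⌊y / lam⌋₊ ≤ (y : ℝ) := by nlinarith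
  generalize ⌊y / lam⌋₊ = p at *
  have hp : 1 ≤ p := by
    by_contra hp
    obtain rfl : p = 0 := by omega
    have := h.le_bucket
    simp only [Nat.cast_zero, mul_zero] at h5
    nlinarith
  refine ⟨B (f ++ [p]), ?_, hl, h.le_sum.trans (by simp), h.bucket_le, h.le_bucket,
    h.fill_nonneg, h.fill_le, fun i => ?_, fun u hu => ?_, ?_⟩
  · intro x hx
    rcases List.mem_append.1 hx with hx | hx
    · exact h.pos x hx
    · rwa [List.mem_singleton.1 hx]
  · have := h.load i
    rw [stratLoad_append_singleton]
    push_cast [-Nat.cast_list_sum]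
    by_cases hi : B (f ++ [p]) = i
    · simp only [hi, if_true]; linarith
    · simp only [hi, if_false]; linarith
  · obtain ⟨i, u₁, hu₁, hu⟩ := isLoad_append_singleton.1 hu
    obtain ⟨u', hu', hle⟩ := h.dom u₁ hu₁
    refine ⟨_, List.append_assoc l₀ f [p] ▸ hu'.append_singleton p i, fun k => ?_⟩
    have := hle k
    rw [hu k]
    split_ifs <;> push_cast [-Nat.cast_list_sum] <;> linarith
  · have := h.volume
    rw [List.sum_append, List.sum_append, List.sum_singleton, List.sum_singleton]
    push_cast [-Nat.cast_list_sum]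
    linarith

/-- Since the play has doubled, the old error terms are at most half as large relative to the new
total, which leaves room for the fresh error `η` of the rounding. So the constant `4` in the
invariant survives any number of jumps. -/
theorem jump (h : Tracks η B l₀ w₀ T₀ β f lam o μ l L) (hη : 0 < η) (hη1 : η ≤ 1)
    (hT : 2 * T₀ ≤ l₀.sum + f.sum) {f' : List ℕ} (hf' : ∀ p ∈ f', 1 ≤ p) {T' β' : ℕ}
    (hT' : T' = l₀.sum + f'.sum) (hβ₁ : (β' : ℝ) ≤ η * T') (hβ₂ : 2 ≤ η * (η * β'))
    (hload : ∀ i, ((w₀ i + stratLoad B f i : ℕ) : ℝ) / (l₀.sum + f.sum : ℕ) ≤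
      ((w₀ i + stratLoad B f' i : ℕ) : ℝ) / (l₀.sum + f'.sum : ℕ) + η)
    (hdom : ∀ u : Fin m → ℕ, IsLoad (l₀ ++ f) u → ∃ u' : Fin m → ℕ, IsLoad (l₀ ++ f') u' ∧
      ∀ i, (u' i : ℝ) / (l₀.sum + f'.sum : ℕ) ≤ (u i : ℝ) / (l₀.sum + f.sum : ℕ) + η) :
    ∃ lam' o', Tracks η B l₀ w₀ T' β' f' lam' o' μ l L := by
  rw [← hT'] at hload hdom
  have hT'0 : (0 : ℝ) < T' := by
    rcases Nat.eq_zero_or_pos T' with h0 | h0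
    · rw [h0] at hβ₁
      simp only [Nat.cast_zero, mul_zero] at hβ₁
      nlinarith [mul_le_mul_of_nonneg_left hβ₁ hη.le,
        mul_le_mul_of_nonneg_left (mul_le_mul_of_nonneg_left hβ₁ hη.le) hη.le]
    · exact_mod_cast h0
  have hT0 : (0 : ℝ) < T₀ := by
    have h1 := h.bucket_pos
    have h2 := h.bucket_le
    have h3 : (1 : ℝ) ≤ β := by exact_mod_cast h1
    by_contra h0
    nlinarith
  have hl := h.lam_pos
  have hv : 2 * (T₀ : ℝ) ≤ (l₀.sum + f.sum : ℕ) := by exact_mod_cast hT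
  have hvol := h.volume
  have hvsum : (l₀.sum + f.sum : ℝ) = (l₀.sum + f.sum : ℕ) := by push_cast [-Nat.cast_list_sum]; rfl
  rw [hvsum] at hvol
  have hloads := fun i => h.load i
  have hdoms := h.dom
  have hbl := h.bucket_le
  have hfn := h.fill_nonneg
  have hfl := h.fill_le
  generalize l₀.sum + f.sum = T at *
  have hTpos : (0 : ℝ) < T := by linarith
  have hscale : lam * T / T' * T' = lam * T := by field_simp
  have hbl' : lam * β ≤ η * (lam * T₀) := by nlinarith
  have hlT : 2 * (lam * T₀) ≤ lam * T := by nlinarith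
  have hηl : 0 < η * (lam * T₀) := by positivity
  have hηlT : 2 * (η * (lam * T₀)) ≤ η * (lam * T) := by nlinarith
  -- The new scale keeps the scaled total size unchanged. The bucket is declared full, so no room is
  -- reserved and its machine is immaterial.
  refine ⟨lam * T / T', (1 + η) * (lam * T / T' * β'), hf', by positivity, hT'.le, hβ₁, hβ₂,
    by positivity, le_rfl, fun i => ?_, fun u hu => ?_, ?_⟩
  · rw [sub_self, ite_self, add_zero, hscale]
    have h1 := hloads i
    have h2 : lam * T * (((w₀ i + stratLoad B f i : ℕ) : ℝ) / T) ≤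
        lam * T * (((w₀ i + stratLoad B f' i : ℕ) : ℝ) / T' + η) :=
      mul_le_mul_of_nonneg_left (hload i) (by positivity)
    have h3 : lam * T * (((w₀ i + stratLoad B f i : ℕ) : ℝ) / T) =
        lam * (w₀ i + stratLoad B f i) := by push_cast [-Nat.cast_list_sum]; field_simp
    have h4 : lam * T * (((w₀ i + stratLoad B f' i : ℕ) : ℝ) / T' + η) =
        lam * T / T' * (w₀ i + stratLoad B f' i) + η * (lam * T) := by push_cast [-Nat.cast_list_sum]; field_simp
    rw [h3, h4] at h2
    have h5 : 0 ≤ (if μ = i then (1 + η) * (lam * β) - o else 0) := by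
      split_ifs <;> linarith
    have h6 := mul_le_mul_of_nonneg_left h2 (by linarith : 0 ≤ 1 + η)
    have h7 : η * (η * (lam * T)) ≤ 1 * (η * (lam * T)) :=
      mul_le_mul_of_nonneg_right hη1 (by positivity)
    linarith
  · obtain ⟨u₁, hu₁, h1⟩ := hdoms u hu
    obtain ⟨u', hu', h2⟩ := hdom u₁ hu₁
    refine ⟨u', hu', fun i => ?_⟩
    have h3 := mul_le_mul_of_nonneg_left (h2 i) (by positivity : 0 ≤ lam * T)
    have h4 : lam * T * ((u' i : ℝ) / T') = lam * T / T' * u' i := by field_simp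
    have h5 : lam * T * ((u₁ i : ℝ) / T + η) = lam * u₁ i + η * (lam * T) := by field_simp
    rw [h4, h5] at h3
    have h6 : 0 ≤ lam * T / T' * β' := by positivity
    have h7 := h1 i
    rw [hscale]
    linarith
  · have : (l₀.sum + f'.sum : ℝ) = T' := by rw [hT']; push_cast [-Nat.cast_list_sum]; rfl
    rw [this, hscale]
    have hm : (1 : ℝ) ≤ m := by
      have : 0 < m := μ.pos
      exact_mod_cast this
    have h1 : 1 * (η * (lam * T)) ≤ m * (η * (lam * T)) :=
      mul_le_mul_of_nonneg_right hm (by positivity)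
    have h2 : m * (2 * (η * (lam * T₀))) ≤ m * (η * (lam * T)) :=
      mul_le_mul_of_nonneg_left hηlT (by positivity)
    have h3 : η * (lam * β) ≤ 1 * (lam * β) :=
      mul_le_mul_of_nonneg_right hη1 (by positivity)
    linarith

/-- All additive errors are multiples of `η * (lam * T₀)`. The total work is at most the total speed
times the optimum, and `W` compares the total speed with each single one, so these errors are small
even on the slowest machine. -/
theorem ratio_le [NeZero m] {q : Fin m → ℝ} (hq : ∀ i, 0 < q i) {W r : ℝ} (hr : 1 ≤ r)
    (hW : ∀ i, ∑ k, q k ≤ W * q i) (hη : 0 < η) (hη1 : η ≤ 1) (hηm : (8 * m + 4) * η ≤ 1)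
    (h : Tracks η B l₀ w₀ T₀ β f lam o μ l L)
    (hB : ∀ i, ((w₀ i + stratLoad B f i : ℕ) : ℝ) ≤ r * opt q (l₀ ++ f) * q i) (i : Fin m) :
    (L i : ℝ) ≤ r * (1 + 33 * W * η) * opt q l * q i := by
  have hl := h.lam_pos
  have hbl : lam * β ≤ η * (lam * T₀) := by nlinarith [h.bucket_le]
  have hT0 : 0 ≤ lam * T₀ := by positivity
  have hTl : lam * T₀ ≤ 2 * l.sum := by
    have h1 := h.volume
    have h2 := h.fill_nonneg
    have h3 : lam * T₀ ≤ lam * (l₀.sum + f.sum) := by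
      have := h.le_sum
      gcongr
      exact_mod_cast this
    have h4 : η * (lam * β) ≤ 1 * (lam * β) :=
      mul_le_mul_of_nonneg_right hη1 (by positivity)
    have h5 := mul_le_mul_of_nonneg_right hηm hT0
    linarith
  have hO := opt_nonneg hq l
  have hTO : ∀ i, lam * T₀ ≤ 2 * (W * opt q l) * q i := fun i => by
    have h1 := sum_le_mul_opt hq l
    have h2 := mul_le_mul_of_nonneg_right (hW i) hO
    linarith
  have hW1 : 1 ≤ W := by
    have h1 := hW i
    have h2 := Finset.single_le_sum (f := q) (fun k _ => (hq k).le) (Finset.mem_univ i)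
    by_contra hlt
    nlinarith [hq i]
  have hopt : lam * opt q (l₀ ++ f) ≤ opt q l + 12 * W * η * opt q l := by
    obtain ⟨u, hu, hule⟩ := exists_isLoad_le_opt hq l
    obtain ⟨u', hu', hle⟩ := h.dom u hu
    rw [← le_div_iff₀' hl]
    refine opt_le hq hu' fun k => ?_
    rw [div_mul_eq_mul_div, le_div_iff₀' hl]
    have h1 := hle k
    have h2 := hule k
    have h3 := mul_le_mul_of_nonneg_left (hTO k) hη.le
    nlinarith
  have h1 := h.load i
  have h2 : 0 ≤ (if μ = i then (1 + η) * (lam * β) - o else 0) := by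
    have := h.fill_le
    split_ifs <;> linarith
  have h3 := mul_le_mul_of_nonneg_left (hB i) hl.le
  have h4 : lam * (r * opt q (l₀ ++ f) * q i) ≤
      r * (opt q l + 12 * W * η * opt q l) * q i := by
    have := mul_le_mul_of_nonneg_left hopt (mul_nonneg (by linarith : 0 ≤ r) (hq i).le)
    linarith
  have h5 := mul_le_mul_of_nonneg_left (hTO i) hη.le
  set X := opt q l * q i with hX
  have hX0 : 0 ≤ X := mul_nonneg hO (hq i).le
  have h6 : (L i : ℝ) ≤ (1 + η) * (r * (1 + 12 * W * η) * X) + 8 * η * W * X := by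
    push_cast [-Nat.cast_list_sum] at h3
    have := mul_le_mul_of_nonneg_left (h3.trans h4) (by linarith : 0 ≤ 1 + η)
    rw [hX]
    linarith
  refine h6.trans ?_
  -- `33 = 1 + 12 + 12 + 8`, using `1 ≤ W`, `η ≤ 1` and `1 ≤ r`.
  have h7 : (1 + η) * (r * (1 + 12 * W * η)) + 8 * η * W ≤ r * (1 + 33 * W * η) := by
    have h8 : 0 ≤ (r - 1) * (8 * η * W) := mul_nonneg (by linarith) (by positivity)
    have h9 : 0 ≤ r * (W - 1) * η := by
      have : 0 ≤ W - 1 := by linarith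
      positivity
    have h10 : 0 ≤ r * W * η * (1 - η) := by
      have : 0 ≤ 1 - η := by linarith
      positivity
    linarith
  calc _ = ((1 + η) * (r * (1 + 12 * W * η)) + 8 * η * W) * X := by ring
    _ ≤ r * (1 + 33 * W * η) * X := mul_le_mul_of_nonneg_right h7 hX0
    _ = _ := by rw [hX]; ring

end Tracks

/-- Everything before `y` is negligible against `y`, and `l₀` is negligible against `H`. So the
history can be forgotten: the play restarts with the single job `H`, at the scale that turns `H`
into `y`. -/
theorem tracks_giant [NeZero m] {η : ℝ} (hη : 0 < η) (B : List ℕ → Fin m) {l₀ : List ℕ}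
    {w₀ : Fin m → ℕ} {H β : ℕ} (hH : 1 ≤ H) (hH₀ : (l₀.sum : ℝ) ≤ 4 * η * H)
    (hβ₁ : (β : ℝ) ≤ η * (l₀.sum + H : ℕ)) (hβ₂ : 2 ≤ η * (η * β)) {l : List ℕ} {L : Fin m → ℕ}
    {y : ℕ} (hy : 1 ≤ y) (hL : ∀ i, (L i : ℝ) ≤ 4 * η * y) :
    ∃ lam o i, Tracks η B l₀ w₀ (l₀.sum + H) β [H] lam o i (l ++ [y])
      (fun k => L k + if i = k then y else 0) := by
  have hH' : (0 : ℝ) < H := by exact_mod_cast hH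
  have hy' : (0 : ℝ) < y := by exact_mod_cast hy
  have hscale : (y : ℝ) / H * H = y := by field_simp
  have hlam : (0 : ℝ) < y / H := by positivity
  have hT : (y : ℝ) ≤ y / H * (l₀.sum + H : ℕ) := by
    push_cast [-Nat.cast_list_sum]
    rw [mul_add, hscale]
    have : 0 ≤ (y : ℝ) / H * l₀.sum := by positivity
    linarith
  have hηy : η * (y : ℝ) ≤ η * (y / H * (l₀.sum + H : ℕ)) :=
    mul_le_mul_of_nonneg_left hT hη.le
  refine ⟨y / H, (1 + η) * (y / H * β), B [H], by simpa using hH, hlam, by simp, hβ₁, hβ₂,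
    by positivity, le_rfl, fun i => ?_, fun u hu => ?_, ?_⟩
  · rw [sub_self, ite_self, add_zero, stratLoad_cons, stratLoad_nil, add_zero]
    have h1 := hL i
    push_cast [-Nat.cast_list_sum] at hηy ⊢
    split_ifs
    · have : 0 ≤ (1 + η) * (y / H * w₀ i) := by positivity
      have : 0 ≤ η * (y : ℝ) := by positivity
      rw [mul_add (y / H : ℝ), hscale]
      linarith
    · have : 0 ≤ (1 + η) * (y / H * w₀ i) := by positivity
      simp only [add_zero]
      linarith
  · obtain ⟨i, u₁, hu₁, hu⟩ := isLoad_append_singleton.1 hu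
    obtain ⟨v, hv⟩ := exists_isLoad (m := m) l₀
    refine ⟨_, hv.append_singleton H i, fun k => ?_⟩
    have h1 : (v k : ℝ) ≤ l₀.sum := by exact_mod_cast hv.le_sum k
    have h2 : (y : ℝ) / H * v k ≤ 4 * η * y := by
      calc (y : ℝ) / H * v k ≤ y / H * (4 * η * H) := by gcongr; linarith
        _ = 4 * η * (y / H * H) := by ring
        _ = _ := by rw [hscale]
    have h3 : 0 ≤ (y : ℝ) / H * β := by positivity
    have h4 : 0 ≤ (u₁ k : ℝ) := by positivity
    rw [hu k]
    split_ifs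
    · push_cast [-Nat.cast_list_sum] at hηy ⊢
      rw [mul_add (y / H : ℝ), hscale]
      linarith
    · push_cast [-Nat.cast_list_sum] at hηy ⊢
      linarith
  · have hm : (1 : ℝ) ≤ m := by exact_mod_cast NeZero.one_le
    have h1 : (y : ℝ) / H * l₀.sum ≤ 4 * η * y := by
      calc (y : ℝ) / H * l₀.sum ≤ y / H * (4 * η * H) := by gcongr
        _ = 4 * η * (y / H * H) := by ring
        _ = _ := by rw [hscale]
    have h2 : 1 * (η * (y / H * (l₀.sum + H : ℕ))) ≤ m * (η * (y / H * (l₀.sum + H : ℕ))) :=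
      mul_le_mul_of_nonneg_right hm (by positivity)
    rw [List.sum_append, List.sum_singleton]
    push_cast [-Nat.cast_list_sum] at *
    simp only [List.sum_cons, List.sum_nil, add_zero]
    have h3 : 0 ≤ (l.sum : ℝ) := by positivity
    rw [mul_add (y / H : ℝ) (l₀.sum : ℝ), hscale]
    rw [mul_add (y / H : ℝ) (l₀.sum : ℝ), hscale] at h2 hηy
    linarith

theorem tracks_self {η : ℝ} (hη : 0 < η) (B : List ℕ → Fin m) {l₀ : List ℕ} {w₀ : Fin m → ℕ}
    {f : List ℕ} (hf : ∀ p ∈ f, 1 ≤ p) {T₀ β : ℕ} (hT : T₀ = l₀.sum + f.sum)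
    (hβ₁ : (β : ℝ) ≤ η * T₀) (hβ₂ : 2 ≤ η * (η * β)) (μ : Fin m) :
    Tracks η B l₀ w₀ T₀ β f 1 ((1 + η) * (1 * β)) μ (l₀ ++ f)
      (fun i => w₀ i + stratLoad B f i) := by
  refine ⟨hf, one_pos, hT.le, hβ₁, hβ₂, by positivity, le_rfl, fun i => ?_,
    fun u hu => ⟨u, hu, fun i => ?_⟩, ?_⟩
  · rw [sub_self, ite_self]
    push_cast [-Nat.cast_list_sum]
    have : 0 ≤ η * (w₀ i + stratLoad B f i) := by positivity
    have : 0 ≤ η * (T₀ : ℝ) := by positivity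
    linarith
  · have : 0 ≤ η * (T₀ : ℝ) := by positivity
    have : (0 : ℝ) ≤ β := by positivity
    linarith
  · have : 0 ≤ m * η * (T₀ : ℝ) := by positivity
    rw [List.sum_append]
    push_cast [-Nat.cast_list_sum]
    linarith

/-! ### Rounded states and their recurrence. -/

theorem exists_le_card_subset {κ : Type*} [Fintype κ] (S : ℕ → Set κ) (hS : Monotone S) :
    ∃ j ≤ Fintype.card κ, S (j + 1) ⊆ S j := by
  by_contra! h
  have key : ∀ j ≤ Fintype.card κ + 1, j ≤ (S j).ncard := by
    intro j
    induction j with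
    | zero => simp
    | succ j ih =>
      intro hj
      have h1 := ih (by omega)
      have h2 : (S j).ncard < (S (j + 1)).ncard :=
        Set.ncard_lt_ncard ⟨hS (Nat.le_succ j), h j (by omega)⟩ (Set.toFinite _)
      omega
  have h1 := key _ le_rfl
  have h2 : (S (Fintype.card κ + 1)).ncard ≤ Fintype.card κ := by
    rw [← Nat.card_eq_fintype_card]; exact Set.ncard_le_card _
  omega

/-- The state reached by the play `f`, rescaled to total processing time `1` and rounded with
precision `1 / D`: the loads, and the capacities that suffice for the jobs. -/
def roundedState (D : ℕ) (B : List ℕ → Fin m) (l₀ : List ℕ) (w₀ : Fin m → ℕ) (f : List ℕ) :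
    (Fin m → Fin (D + 1)) × Set (Fin m → Fin (D + 1)) :=
  (fun i => ⟨min D (D * (w₀ i + stratLoad B f i) / (l₀.sum + f.sum)), by omega⟩,
    {g | ∃ u : Fin m → ℕ, IsLoad (l₀ ++ f) u ∧ ∀ i, D * u i ≤ g i * (l₀.sum + f.sum)})

theorem load_le_of_roundedState_eq {D : ℕ} (hD : 0 < D) {B : List ℕ → Fin m} {l₀ : List ℕ}
    {w₀ : Fin m → ℕ} (hw₀ : ∀ i, w₀ i ≤ l₀.sum) {f f' : List ℕ} (hf : 0 < l₀.sum + f.sum)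
    (hf' : 0 < l₀.sum + f'.sum)
    (h : roundedState D B l₀ w₀ f = roundedState D B l₀ w₀ f') (i : Fin m) :
    ((w₀ i + stratLoad B f i : ℕ) : ℝ) / (l₀.sum + f.sum : ℕ) ≤
      ((w₀ i + stratLoad B f' i : ℕ) : ℝ) / (l₀.sum + f'.sum : ℕ) + (D : ℝ)⁻¹ := by
  have key := congrArg Fin.val (congrFun (congrArg Prod.fst h) i)
  have h1 : w₀ i + stratLoad B f i ≤ l₀.sum + f.sum :=
    add_le_add (hw₀ i) (stratLoad_le_sum B f i)
  simp only [roundedState] at key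
  generalize w₀ i + stratLoad B f i = x at *
  generalize w₀ i + stratLoad B f' i = x' at *
  generalize l₀.sum + f.sum = T at *
  generalize l₀.sum + f'.sum = T' at *
  have h2 : D * x / T ≤ D := Nat.div_le_of_le_mul (by rw [mul_comm T]; gcongr)
  have h3 : D * x / T ≤ D * x' / T' := by omega
  have h4 : D * x < T * (D * x / T + 1) := Nat.lt_mul_div_succ _ hf
  have h5 : T' * (D * x' / T') ≤ D * x' := Nat.mul_div_le _ _
  generalize D * x / T = a at *
  generalize D * x' / T' = b at *
  have hD' : (0 : ℝ) < D := by exact_mod_cast hD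
  have hT : (0 : ℝ) < T := by exact_mod_cast hf
  have hT' : (0 : ℝ) < T' := by exact_mod_cast hf'
  have h6 : (x : ℝ) / T ≤ (a + 1) / D := by
    rw [div_le_div_iff₀ hT hD']
    have : (D : ℝ) * x ≤ T * (a + 1) := by exact_mod_cast h4.le
    linarith
  have h7 : (b : ℝ) / D ≤ x' / T' := by
    rw [div_le_div_iff₀ hD' hT']
    have : (T' : ℝ) * b ≤ D * x' := by exact_mod_cast h5
    linarith
  have h8 : (a : ℝ) / D ≤ b / D := by
    gcongr
  rw [add_div, one_div] at h6
  linarith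

/-- Round the loads `u` up to a capacity vector. It suffices for the jobs of the first play, hence
also for those of the second, and any packing into it serves as `u'`. -/
theorem dom_of_roundedState_eq {D : ℕ} (hD : 0 < D) {B : List ℕ → Fin m} {l₀ : List ℕ}
    {w₀ : Fin m → ℕ} {f f' : List ℕ} (hf : 0 < l₀.sum + f.sum) (hf' : 0 < l₀.sum + f'.sum)
    (h : roundedState D B l₀ w₀ f = roundedState D B l₀ w₀ f') {u : Fin m → ℕ}
    (hu : IsLoad (l₀ ++ f) u) :
    ∃ u' : Fin m → ℕ, IsLoad (l₀ ++ f') u' ∧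
      ∀ i, (u' i : ℝ) / (l₀.sum + f'.sum : ℕ) ≤
        (u i : ℝ) / (l₀.sum + f.sum : ℕ) + (D : ℝ)⁻¹ := by
  have key := congrArg Prod.snd h
  have hle : ∀ i, u i ≤ l₀.sum + f.sum := fun i => by simpa using hu.le_sum i
  simp only [roundedState] at key
  generalize l₀.sum + f.sum = T at *
  generalize l₀.sum + f'.sum = T' at *
  -- The cap at `D` is harmless, because no load exceeds the total `T`.
  let g : Fin m → Fin (D + 1) := fun i => ⟨min D (D * u i / T + 1), by omega⟩
  obtain ⟨u', hu', hg⟩ : g ∈ {g : Fin m → Fin (D + 1) | ∃ u : Fin m → ℕ,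
      IsLoad (l₀ ++ f') u ∧ ∀ i, D * u i ≤ g i * T'} := by
    rw [← key]
    refine ⟨u, hu, fun i => ?_⟩
    have h1 : D * u i < T * (D * u i / T + 1) := Nat.lt_mul_div_succ _ hf
    have h2 : D * u i ≤ D * T := Nat.mul_le_mul_left _ (hle i)
    simp only [g]
    rcases min_cases D (D * u i / T + 1) with ⟨h, -⟩ | ⟨h, -⟩ <;> rw [h]
    · exact h2
    · exact h1.le.trans_eq (mul_comm _ _)
  refine ⟨u', hu', fun i => ?_⟩
  have h3 : D * u' i ≤ (D * u i / T + 1) * T' :=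
    (hg i).trans (Nat.mul_le_mul_right _ (min_le_right _ _))
  have h5 : T * (D * u i / T) ≤ D * u i := Nat.mul_div_le _ _
  generalize D * u i / T = a at *
  have hD' : (0 : ℝ) < D := by exact_mod_cast hD
  have hT : (0 : ℝ) < T := by exact_mod_cast hf
  have hT' : (0 : ℝ) < T' := by exact_mod_cast hf'
  have h6 : (u' i : ℝ) / T' ≤ (a + 1) / D := by
    rw [div_le_div_iff₀ hT' hD']
    have : (D : ℝ) * u' i ≤ (a + 1) * T' := by exact_mod_cast h3
    linarith
  have h7 : (a : ℝ) / D ≤ u i / T := by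
    rw [div_le_div_iff₀ hD' hT]
    have : (T : ℝ) * a ≤ D * u i := by exact_mod_cast h5
    linarith
  rw [add_div, one_div] at h6
  linarith

/-- A bound on the total processing time such that a strategy that is safe up to it can be turned
into one that is safe forever. -/
def horizon (m D X : ℕ) : ℕ :=
  (2 * D ^ 3 + D * X) * (2 * D + 2) ^ ((D + 1) ^ m * 2 ^ (D + 1) ^ m + 2)

/-- The sets of rounded states reachable within growing size bounds increase inside a finite type,
so two consecutive ones coincide after at most as many steps as there are states. -/
theorem exists_recurrent (D : ℕ) (B : List ℕ → Fin m) (l₀ : List ℕ) (w₀ : Fin m → ℕ)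
    (H K : ℕ) (hK : 1 ≤ K) :
    ∃ j ≤ (D + 1) ^ m * 2 ^ (D + 1) ^ m, ∀ f : List ℕ, (∀ p ∈ f, 1 ≤ p) → H ≤ l₀.sum + f.sum →
      l₀.sum + f.sum ≤ H * K ^ (j + 2) →
      ∃ f' : List ℕ, (∀ p ∈ f', 1 ≤ p) ∧ H ≤ l₀.sum + f'.sum ∧
        l₀.sum + f'.sum ≤ H * K ^ (j + 1) ∧
        roundedState D B l₀ w₀ f = roundedState D B l₀ w₀ f' := by
  classical
  let S : ℕ → Set ((Fin m → Fin (D + 1)) × Set (Fin m → Fin (D + 1))) := fun j =>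
    roundedState D B l₀ w₀ '' {f | (∀ p ∈ f, 1 ≤ p) ∧ H ≤ l₀.sum + f.sum ∧
      l₀.sum + f.sum ≤ H * K ^ (j + 1)}
  have hS : Monotone S := by
    intro i j hij
    refine Set.image_mono fun f hf => ⟨hf.1, hf.2.1, hf.2.2.trans ?_⟩
    gcongr
  obtain ⟨j, hj, hsub⟩ := exists_le_card_subset S hS
  refine ⟨j, by simpa using hj, fun f hf h1 h2 => ?_⟩
  obtain ⟨f', ⟨h3, h4, h5⟩, h6⟩ := hsub ⟨f, ⟨hf, h1, h2⟩, rfl⟩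
  exact ⟨f', h3, h4, h5, h6.symm⟩

theorem bucket_bounds {D T : ℕ} (hD : 0 < D) (hT : 2 * D ^ 3 ≤ T) :
    ((T / D : ℕ) : ℝ) ≤ (D : ℝ)⁻¹ * T ∧ 2 ≤ (D : ℝ)⁻¹ * ((D : ℝ)⁻¹ * (T / D : ℕ)) := by
  have hD' : (0 : ℝ) < D := by exact_mod_cast hD
  constructor
  · rw [inv_mul_eq_div]; exact Nat.cast_div_le
  · have h1 : 2 * D ^ 2 ≤ T / D := by
      rw [Nat.le_div_iff_mul_le hD]
      calc 2 * D ^ 2 * D = 2 * D ^ 3 := by ring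
        _ ≤ T := hT
    have h2 : (2 : ℝ) * D ^ 2 ≤ (T / D : ℕ) := by exact_mod_cast h1
    rw [← mul_assoc, ← mul_inv, ← sq, inv_mul_eq_div, le_div_iff₀ (by positivity)]
    exact h2

theorem Tracks.load_le {D : ℕ} (hD : 8 * m + 4 ≤ D) {B : List ℕ → Fin m}
    {l₀ : List ℕ} {w₀ : Fin m → ℕ} (hw₀ : ∀ i, w₀ i ≤ l₀.sum) {T₀ β : ℕ} {f : List ℕ}
    {lam o : ℝ} {μ : Fin m} {l : List ℕ} {L : Fin m → ℕ}
    (h : Tracks (D : ℝ)⁻¹ B l₀ w₀ T₀ β f lam o μ l L) (i : Fin m) :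
    (L i : ℝ) ≤ 4 * (lam * (l₀.sum + f.sum : ℕ)) := by
  have hD' : (0 : ℝ) < D := by
    have : 0 < D := by omega
    exact_mod_cast this
  have hη : (0 : ℝ) < (D : ℝ)⁻¹ := by positivity
  have hη1 : 4 * (D : ℝ)⁻¹ ≤ 1 := by
    rw [← div_eq_mul_inv, div_le_one hD']
    have : 4 ≤ D := by omega
    exact_mod_cast this
  have h1 := h.load i
  have h2 : 0 ≤ (if μ = i then (1 + (D : ℝ)⁻¹) * (lam * β) - o else 0) := by
    have := h.fill_le
    split_ifs <;> linarith
  have h3 : lam * (w₀ i + stratLoad B f i) ≤ lam * (l₀.sum + f.sum : ℕ) := by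
    have := h.lam_pos
    gcongr
    exact_mod_cast add_le_add (hw₀ i) (stratLoad_le_sum B f i)
  have h4 : lam * (T₀ : ℝ) ≤ lam * (l₀.sum + f.sum : ℕ) := by
    have := h.lam_pos
    have := h.le_sum
    gcongr
  have h5 : 0 ≤ lam * (T₀ : ℝ) := by have := h.lam_pos; positivity
  have h6 : 0 ≤ lam * ((l₀.sum + f.sum : ℕ) : ℝ) := by have := h.lam_pos; positivity
  have h7 := mul_le_mul_of_nonneg_left h3 (by linarith : 0 ≤ 1 + (D : ℝ)⁻¹)
  have h8 := mul_le_mul_of_nonneg_right hη1 h5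
  have h9 := mul_le_mul_of_nonneg_right hη1 h6
  linarith

/-! ### The simulation strategy and the truncation theorem. -/

/-- The invariant of the simulation: either the play still follows the real jobs exactly, or it
tracks them approximately and has not grown much since it was last rounded. -/
def Simulates (D H N : ℕ) (B : List ℕ → Fin m) (l₀ : List ℕ) (w₀ : Fin m → ℕ)
    (l : List ℕ) (L : Fin m → ℕ) : Prop :=
  (∃ f : List ℕ, (∀ p ∈ f, 1 ≤ p) ∧ l = l₀ ++ f ∧ (L = fun i => w₀ i + stratLoad B f i) ∧
    l₀.sum + f.sum < H) ∨
  ∃ f T₀ lam o μ, Tracks (D : ℝ)⁻¹ B l₀ w₀ T₀ (T₀ / D) f lam o μ l L ∧ H ≤ T₀ ∧ T₀ ≤ N ∧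
    l₀.sum + f.sum < 2 * T₀

section Step

variable {D H N : ℕ} {B : List ℕ → Fin m} {l₀ : List ℕ} {w₀ : Fin m → ℕ}

theorem simulates_giant [NeZero m] (hD : 8 * m + 4 ≤ D) (hH : 2 * D ^ 3 + D * l₀.sum ≤ H)
    (hN : 2 * H ≤ N) {l : List ℕ} {L : Fin m → ℕ} {y : ℕ} (hy : 1 ≤ y)
    (hL : ∀ i, (L i : ℝ) ≤ 4 * (D : ℝ)⁻¹ * y) :
    ∃ i, Simulates D H N B l₀ w₀ (l ++ [y]) (fun k => L k + if i = k then y else 0) := by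
  have hD0 : 0 < D := by omega
  have hD' : (0 : ℝ) < D := by exact_mod_cast hD0
  have hX : l₀.sum ≤ D * l₀.sum := Nat.le_mul_of_pos_left _ hD0
  have hH0 : 0 < 2 * D ^ 3 := by positivity
  obtain ⟨h1, h2⟩ := bucket_bounds hD0 (by omega : 2 * D ^ 3 ≤ l₀.sum + H)
  have h3 : (l₀.sum : ℝ) ≤ 4 * (D : ℝ)⁻¹ * H := by
    have : (D : ℝ) * l₀.sum ≤ H := by
      have : D * l₀.sum ≤ H := by omega
      exact_mod_cast this
    have : (l₀.sum : ℝ) ≤ (D : ℝ)⁻¹ * H := by rwa [inv_mul_eq_div, le_div_iff₀' hD']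
    have : (0 : ℝ) ≤ (D : ℝ)⁻¹ * H := by positivity
    linarith
  obtain ⟨lam, o, i, h⟩ := tracks_giant (by positivity) B (w₀ := w₀) (by omega : 1 ≤ H) h3 h1 h2
    (l := l) hy hL
  exact ⟨i, Or.inr ⟨[H], _, lam, o, i, h, by omega, by omega, by simp; omega⟩⟩

theorem Simulates.step [NeZero m] (hD : 8 * m + 4 ≤ D) (hw₀ : ∀ i, w₀ i ≤ l₀.sum)
    (hH : 2 * D ^ 3 + D * l₀.sum ≤ H) (hHN : (2 * D + 2) * H ≤ N)
    (hrec : ∀ f : List ℕ, (∀ p ∈ f, 1 ≤ p) → H ≤ l₀.sum + f.sum →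
      l₀.sum + f.sum ≤ (2 * D + 2) * N →
      ∃ f' : List ℕ, (∀ p ∈ f', 1 ≤ p) ∧ H ≤ l₀.sum + f'.sum ∧ l₀.sum + f'.sum ≤ N ∧
        roundedState D B l₀ w₀ f = roundedState D B l₀ w₀ f')
    {l : List ℕ} {L : Fin m → ℕ} (h : Simulates D H N B l₀ w₀ l L) {y : ℕ} (hy : 1 ≤ y) :
    ∃ i, Simulates D H N B l₀ w₀ (l ++ [y]) (fun k => L k + if i = k then y else 0) := by
  have hD0 : 0 < D := by omega
  have hD' : (0 : ℝ) < D := by exact_mod_cast hD0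
  have hη : (0 : ℝ) < (D : ℝ)⁻¹ := by positivity
  have hη1 : (D : ℝ)⁻¹ ≤ 1 := inv_le_one_of_one_le₀ (by exact_mod_cast hD0)
  have hH0 : 0 < 2 * D ^ 3 := by positivity
  have hN : 2 * H ≤ N := le_trans (Nat.mul_le_mul_right _ (by omega)) hHN
  -- A job at least `D` times the current scale of the instance restarts the play. All others
  -- enlarge the total by a factor of at most `D + 1`, so that a single step cannot leave the range
  -- of `hrec`.
  have hgiant : ∀ x : ℝ, D * x ≤ y → (∀ i, (L i : ℝ) ≤ 4 * x) →
      ∃ i, Simulates D H N B l₀ w₀ (l ++ [y]) (fun k => L k + if i = k then y else 0) := by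
    intro x hx hL
    refine simulates_giant hD hH hN hy fun i => (hL i).trans ?_
    have : x ≤ (D : ℝ)⁻¹ * y := by rwa [inv_mul_eq_div, le_div_iff₀' hD']
    linarith
  rcases h with ⟨f, hf, rfl, rfl, hT⟩ | ⟨f, T₀, lam, o, μ, h, hHT, hTN, hT⟩
  · rcases le_or_gt (D * H) y with hy2 | hy2
    · refine hgiant H (by exact_mod_cast hy2) fun i => ?_
      have h1 : w₀ i + stratLoad B f i ≤ H :=
        (add_le_add (hw₀ i) (stratLoad_le_sum B f i)).trans hT.le
      have h2 : ((w₀ i + stratLoad B f i : ℕ) : ℝ) ≤ H := by exact_mod_cast h1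
      have : (0 : ℝ) ≤ H := by positivity
      linarith
    · refine ⟨B (f ++ [y]), ?_⟩
      have hpos : ∀ p ∈ f ++ [y], 1 ≤ p := by
        intro p hp
        rcases List.mem_append.1 hp with hp | hp
        · exact hf p hp
        · rwa [List.mem_singleton.1 hp]
      have hload : (fun k => w₀ k + stratLoad B f k + if B (f ++ [y]) = k then y else 0) =
          fun k => w₀ k + stratLoad B (f ++ [y]) k := by
        funext k
        rw [stratLoad_append_singleton, add_assoc]
      rw [hload, List.append_assoc]
      rcases lt_or_ge (l₀.sum + (f ++ [y]).sum) H with hT2 | hT2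
      · exact Or.inl ⟨_, hpos, rfl, rfl, hT2⟩
      · obtain ⟨h1, h2⟩ := bucket_bounds hD0 (by omega : 2 * D ^ 3 ≤ l₀.sum + (f ++ [y]).sum)
        -- The bucket starts full, so machine `0` is an arbitrary choice.
        refine Or.inr ⟨_, _, _, _, 0, tracks_self hη B hpos rfl h1 h2 0, hT2, ?_, by omega⟩
        rw [List.sum_append, List.sum_singleton]
        nlinarith
  · have hl := h.lam_pos
    rcases le_or_gt (D * (lam * (l₀.sum + f.sum : ℕ))) y with hy2 | hy2
    · exact hgiant _ hy2 fun i => h.load_le hD hw₀ i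
    · obtain ⟨f', o', μ', i, hsum, h'⟩ : ∃ f' o' μ' i, f'.sum ≤ f.sum + D * (l₀.sum + f.sum) ∧
          Tracks (D : ℝ)⁻¹ B l₀ w₀ T₀ (T₀ / D) f' lam o' μ' (l ++ [y])
            (fun k => L k + if i = k then y else 0) := by
        rcases lt_or_ge (y : ℝ) ((D : ℝ)⁻¹ * (lam * (T₀ / D : ℕ))) with hy3 | hy3
        · obtain ⟨f', o', i, h1, h2⟩ := h.small_step hη hη1 hy3
          refine ⟨f', o', i, i, h1.trans ?_, h2⟩
          have h3 := h.le_sum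
          have h4 : T₀ / D ≤ T₀ := Nat.div_le_self _ _
          have h5 : l₀.sum + f.sum ≤ D * (l₀.sum + f.sum) := Nat.le_mul_of_pos_left _ hD0
          omega
        · obtain ⟨i, h2⟩ := h.big_step hη hη1 hy3
          refine ⟨_, o, μ, i, ?_, h2⟩
          rw [List.sum_append, List.sum_singleton]
          gcongr
          refine Nat.floor_le_of_le ?_
          rw [div_le_iff₀ hl]
          push_cast [-Nat.cast_list_sum] at hy2 ⊢
          linarith
      have hsum2 : l₀.sum + f'.sum ≤ (2 * D + 2) * T₀ := by nlinarith
      refine ⟨i, Or.inr ?_⟩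
      rcases lt_or_ge (l₀.sum + f'.sum) (2 * T₀) with hT2 | hT2
      · exact ⟨f', T₀, lam, o', μ', h', hHT, hTN, hT2⟩
      · obtain ⟨f'', hpos, h1, h2, h3⟩ := hrec f' h'.pos (by omega)
          (hsum2.trans (Nat.mul_le_mul_left _ hTN))
        obtain ⟨hb1, hb2⟩ := bucket_bounds hD0 (by omega : 2 * D ^ 3 ≤ l₀.sum + f''.sum)
        obtain ⟨lam', o'', h4⟩ := h'.jump hη hη1 hT2 hpos rfl hb1 hb2
          (load_le_of_roundedState_eq hD0 hw₀ (by omega) (by omega) h3)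
          (fun u hu => dom_of_roundedState_eq hD0 (by omega) (by omega) h3 hu)
        exact ⟨f'', _, lam', o'', μ', h4, h1, h2, by omega⟩

end Step

/-- **Truncation**: an online algorithm that is safe up to the horizon can be turned into one that
is safe forever. -/
theorem safe_of_safeUpTo [NeZero m] {q : Fin m → ℝ} (hq : ∀ i, 0 < q i) {W r : ℝ} (hr : 1 ≤ r)
    (hW : ∀ i, ∑ k, q k ≤ W * q i) {D : ℕ} (hD : 8 * m + 4 ≤ D) {l₀ : List ℕ} {w₀ : Fin m → ℕ}
    (hw₀ : ∀ i, w₀ i ≤ l₀.sum) (h : SafeUpTo (horizon m D l₀.sum : ℕ) q r l₀ w₀) :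
    Safe q (r * (1 + 33 * W / D)) l₀ w₀ := by
  obtain ⟨B, hB⟩ := h
  have hD0 : 0 < D := by omega
  have hD' : (0 : ℝ) < D := by exact_mod_cast hD0
  have hη : (0 : ℝ) < (D : ℝ)⁻¹ := by positivity
  have hη1 : (D : ℝ)⁻¹ ≤ 1 := inv_le_one_of_one_le₀ (by exact_mod_cast hD0)
  have hηm : (8 * m + 4) * (D : ℝ)⁻¹ ≤ 1 := by
    rw [← div_eq_mul_inv, div_le_one hD']
    exact_mod_cast hD
  -- The first summand makes buckets large enough for integer rounding; the second makes `l₀`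
  -- negligible against `H`.
  set H := 2 * D ^ 3 + D * l₀.sum with hH
  have hHpos : 0 < H := by positivity
  obtain ⟨j, hj, hrec⟩ := exists_recurrent D B l₀ w₀ H (2 * D + 2) (by omega)
  have hK : ∀ n, (2 * D + 2) * (H * (2 * D + 2) ^ n) = H * (2 * D + 2) ^ (n + 1) :=
    fun n => by ring
  have hhor : (2 * D + 2) * (H * (2 * D + 2) ^ (j + 1)) ≤ horizon m D l₀.sum := by
    rw [hK, horizon, ← hH]
    exact Nat.mul_le_mul_left _ (Nat.pow_le_pow_right (by omega) (by omega))
  have hHN : (2 * D + 2) * H ≤ H * (2 * D + 2) ^ (j + 1) := by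
    rw [mul_comm]
    gcongr
    exact Nat.le_self_pow (by omega) _
  have hle2 : 2 * (H * (2 * D + 2) ^ (j + 1)) ≤ (2 * D + 2) * (H * (2 * D + 2) ^ (j + 1)) :=
    Nat.mul_le_mul_right _ (by omega)
  have hW0 : 0 ≤ W := by
    have h1 := hW 0
    have h2 := Finset.sum_nonneg fun k (_ : k ∈ Finset.univ) => (hq k).le
    by_contra hlt
    nlinarith [hq 0]
  -- Safety of `B` is used only for plays that satisfy the invariant; these stay below twice the
  -- size at which they were last rounded.
  have hBf : ∀ f : List ℕ, (∀ p ∈ f, 1 ≤ p) →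
      l₀.sum + f.sum ≤ 2 * (H * (2 * D + 2) ^ (j + 1)) →
      ∀ i, ((w₀ i + stratLoad B f i : ℕ) : ℝ) ≤ r * opt q (l₀ ++ f) * q i := fun f hf hT =>
    hB f hf (by exact_mod_cast hT.trans (hle2.trans hhor))
  refine safe_of_invariant (Simulates D H (H * (2 * D + 2) ^ (j + 1)) B l₀ w₀) ?_
    (fun l L hl y hy => hl.step hD hw₀ le_rfl hHN (fun f hf h1 h2 => hrec f hf h1 (by rwa [← hK]))
      hy) (Or.inl ⟨[], by simp, by simp, by simp, ?_⟩)
  · rintro l L (⟨f, hf, rfl, rfl, hT⟩ | ⟨f, T₀, lam, o, μ, htr, hHT, hTN, hT⟩) i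
    · refine (hBf f hf ?_ i).trans ?_
      · have : H ≤ (2 * D + 2) * H := Nat.le_mul_of_pos_left _ (by omega)
        omega
      · have h1 := opt_nonneg hq (l₀ ++ f)
        have h2 := (hq i).le
        gcongr
        refine le_mul_of_one_le_right (by linarith) ?_
        have : 0 ≤ 33 * W / D := by positivity
        linarith
    · have := htr.ratio_le hq hr hW hη hη1 hηm (hBf f htr.pos (by omega)) i
      rwa [div_eq_mul_inv]
  · have h1 : 0 < 2 * D ^ 3 := by positivity
    have h2 : l₀.sum ≤ D * l₀.sum := Nat.le_mul_of_pos_left _ hD0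
    simp only [List.sum_nil]
    omega

/-! ### Reduction to finitely many speed vectors. -/

theorem asgLoad_comp {ι κ : Type*} [Fintype ι] [DecidableEq ι] [DecidableEq κ] (l : List ℕ)
    (σ : ℕ → ι) (φ : ι → κ) (i : κ) :
    asgLoad l (fun j => φ (σ j)) i = ∑ k, if φ k = i then asgLoad l σ k else 0 := by
  induction l using List.reverseRecOn with
  | nil => simp
  | append_singleton l p ih =>
    have : ∀ k, (if φ k = i then asgLoad (l ++ [p]) σ k else 0) =
        (if φ k = i then asgLoad l σ k else 0) +
          if σ l.length = k then (if φ k = i then p else 0) else 0 := by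
      intro k
      rw [asgLoad_append_singleton]
      split_ifs <;> simp
    simp_rw [this]
    simp only [Finset.sum_add_distrib, Finset.sum_ite_eq, Finset.mem_univ, if_true,
      asgLoad_append_singleton, ih]

/-- The strategy for the virtual speeds `g` is run with virtual machine `k` hosted on `φ k`. Hosting
costs the factor `a`, and comparing the two optima costs `b`. -/
theorem Safe.of_loads [NeZero m] {g s : Fin m → ℝ} (hg : ∀ i, 0 < g i) (hs : ∀ i, 0 < s i)
    {r a b : ℝ} (hr : 0 ≤ r) (hb : 0 ≤ b) (φ : Fin m → Fin m)
    (hφ : ∀ i, (∑ k, if φ k = i then g k else 0) ≤ a * s i) (hgs : ∀ i, s i ≤ b * g i)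
    (h : Safe g r [] 0) : Safe s (r * (a * b)) [] 0 := by
  obtain ⟨B, hB⟩ := h
  refine ⟨fun f => φ (B f), fun f hf hN i => ?_⟩
  have hload := hB f hf hN
  simp only [Pi.zero_apply, zero_add, List.nil_append] at hload ⊢
  have hOg := opt_nonneg hg f
  have hOs := opt_nonneg hs f
  have ha : 0 ≤ a := by
    have h0 : 0 ≤ ∑ k, if φ k = i then g k else 0 :=
      Finset.sum_nonneg fun k _ => by split_ifs <;> [exact (hg k).le; exact le_rfl]
    have := h0.trans (hφ i)
    by_contra hlt
    nlinarith [hs i]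
  have hopt : opt g f ≤ b * opt s f := by
    obtain ⟨w, hw, hle⟩ := exists_isLoad_le_opt hs f
    refine opt_le hg hw fun k => (hle k).trans ?_
    calc opt s f * s k ≤ opt s f * (b * g k) := by have := hgs k; gcongr
      _ = _ := by ring
  calc ((stratLoad (fun f => φ (B f)) f i : ℕ) : ℝ)
      = ∑ k, if φ k = i then (stratLoad B f k : ℝ) else 0 := by
        rw [stratLoad, asgLoad_comp]; push_cast; rfl
    _ ≤ ∑ k, if φ k = i then r * opt g f * g k else 0 :=
        Finset.sum_le_sum fun k _ => by split_ifs <;> [exact hload k; exact le_rfl]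
    _ = r * opt g f * ∑ k, if φ k = i then g k else 0 := by
        simp only [Finset.mul_sum, mul_ite, mul_zero]
    _ ≤ r * (b * opt s f) * (a * s i) :=
        mul_le_mul (mul_le_mul_of_nonneg_left hopt hr) (hφ i)
          (Finset.sum_nonneg fun k _ => by split_ifs <;> [exact (hg k).le; exact le_rfl])
          (by positivity)
    _ = _ := by ring

/-- Up to scaling and to a loss of `(1 + 1 / Z) ^ 2`, there are only finitely many vectors of
speeds to consider. -/
theorem safe_of_grid [NeZero m] {Z : ℕ} (hZ : 1 ≤ Z) {r : ℝ} (hr : 0 ≤ r)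
    (h : ∀ g : Fin m → ℕ, (∀ i, 1 ≤ g i ∧ g i ≤ m * Z ^ 2) → Safe (fun i => (g i : ℝ)) r [] 0)
    {s : Fin m → ℝ} (hs : ∀ i, 0 < s i) : Safe s (r * (1 + 1 / Z) ^ 2) [] 0 := by
  obtain ⟨i₀, -, hi₀⟩ := Finset.exists_max_image Finset.univ s ⟨0, by simp⟩
  have hm : 1 ≤ m := NeZero.one_le
  have hm' : (1 : ℝ) ≤ m := by exact_mod_cast hm
  have hZ' : (1 : ℝ) ≤ Z := by exact_mod_cast hZ
  -- Scaled this way, the fastest machine can host all machines raised to speed `Z`: their total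
  -- speed `m * Z` is a fraction `1 / Z` of its own.
  set κ : ℝ := (m * Z ^ 2 : ℕ) / s i₀ with hκ
  have hκ₀ : κ * s i₀ = (m * Z ^ 2 : ℕ) := by rw [hκ]; field_simp [(hs i₀).ne']
  have hGpos : 0 < m * Z ^ 2 := by positivity
  have hκpos : 0 < κ := div_pos (by exact_mod_cast hGpos) (hs i₀)
  have hκle : ∀ i, κ * s i ≤ (m * Z ^ 2 : ℕ) := fun i => by
    rw [← hκ₀]; have := hi₀ i (by simp); gcongr
  have hZG : Z ≤ m * Z ^ 2 := by nlinarith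
  let g : Fin m → ℕ := fun i => max ⌊κ * s i⌋₊ Z
  have hg : ∀ i, 1 ≤ g i ∧ g i ≤ m * Z ^ 2 := fun i =>
    ⟨hZ.trans (le_max_right _ _), max_le (Nat.floor_le_of_le (hκle i)) hZG⟩
  have key := h g hg
  have hgZ : ∀ i, (Z : ℝ) ≤ g i := fun i => by exact_mod_cast le_max_right ⌊κ * s i⌋₊ Z
  have h1 : (1 + 1 / (Z : ℝ)) ^ 2 = (κ * (1 + 1 / Z)) * ((1 + 1 / Z) / κ) := by
    field_simp
  rw [h1]
  refine Safe.of_loads (φ := fun k => if κ * s k < Z then i₀ else k) (fun i => ?_) hs hr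
    (by positivity) (fun i => ?_) (fun i => ?_) key
  · have := hgZ i; linarith
  · have hfast : ∀ k, ¬ κ * s k < Z → (g k : ℝ) ≤ κ * s k := fun k hk => by
      have h2 : Z ≤ ⌊κ * s k⌋₊ := Nat.le_floor (not_lt.1 hk)
      simp only [g, max_eq_left h2]
      exact Nat.floor_le (mul_pos hκpos (hs k)).le
    have hslow : ∀ k, κ * s k < Z → (g k : ℝ) ≤ Z := fun k hk => by
      have h2 : ⌊κ * s k⌋₊ ≤ Z := Nat.floor_le_of_le hk.le
      simp only [g, max_eq_right h2]; exact le_rfl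
    calc (∑ k, if (if κ * s k < Z then i₀ else k) = i then (g k : ℝ) else 0)
        ≤ ∑ k, ((if k = i then κ * s i else 0) + if i₀ = i then (Z : ℝ) else 0) := by
          refine Finset.sum_le_sum fun k _ => ?_
          have h2 : 0 < κ * s i := mul_pos hκpos (hs i)
          by_cases hk : κ * s k < Z
          · have := hslow k hk
            simp only [hk, if_true]
            split_ifs <;> linarith
          · have := hfast k hk
            simp only [hk, if_false]
            split_ifs with h3 h4 h4
            · subst h3; linarith
            · subst h3; linarith
            · linarith
            · linarith
      _ = κ * s i + m * if i₀ = i then (Z : ℝ) else 0 := by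
          simp [Finset.sum_add_distrib]
      _ ≤ κ * (1 + 1 / Z) * s i := by
          have h2 : 0 < κ * s i := mul_pos hκpos (hs i)
          split_ifs with h3
          · subst h3
            have : (m : ℝ) * Z = κ * s i₀ * (1 / Z) := by
              rw [hκ₀]; push_cast; field_simp
            rw [this]; linarith
          · have : 0 ≤ κ * s i * (1 / Z) := by positivity
            linarith
  · have h2 : κ * s i < ⌊κ * s i⌋₊ + 1 := Nat.lt_floor_add_one _
    have h3 : (⌊κ * s i⌋₊ : ℝ) ≤ g i := by exact_mod_cast le_max_left ⌊κ * s i⌋₊ Z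
    have h4 : (1 : ℝ) ≤ g i * (1 / Z) := by
      rw [mul_one_div, le_div_iff₀ (by linarith), one_mul]; exact hgZ i
    rw [div_mul_eq_mul_div, le_div_iff₀ hκpos]
    linarith

theorem safe_card [NeZero m] {q : Fin m → ℝ} (hq : ∀ i, 0 < q i) : Safe q m [] 0 := by
  obtain ⟨i₀, -, hi₀⟩ := Finset.exists_max_image Finset.univ q ⟨0, by simp⟩
  refine ⟨fun _ => i₀, fun f _ _ i => ?_⟩
  simp only [Pi.zero_apply, zero_add, List.nil_append]
  have hO := opt_nonneg hq f
  by_cases hi : i₀ = i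
  · subst hi
    have h1 : ∑ k, q k ≤ m * q i₀ := by
      simpa using Finset.sum_le_card_nsmul Finset.univ q (q i₀) fun k hk => hi₀ k hk
    calc ((stratLoad (fun _ => i₀) f i₀ : ℕ) : ℝ) ≤ f.sum := by
          exact_mod_cast stratLoad_le_sum (fun _ => i₀) f i₀
      _ ≤ (∑ k, q k) * opt q f := sum_le_mul_opt hq f
      _ ≤ m * q i₀ * opt q f := by gcongr
      _ = _ := by ring
  · have : stratLoad (fun _ => i₀) f i = 0 := by simp [stratLoad, asgLoad, hi]
    rw [this, Nat.cast_zero]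
    have := (hq i).le
    positivity

/-! ### Bounds on competitive ratios from safety. -/

theorem optimalRatio_le [NeZero m] {r : ℝ≥0}
    (h : ∀ s : Fin m → ℝ, (∀ i, 0 < s i) → Safe s r [] 0) : optimalRatio m ≤ r := by
  classical
  choose B hB using h
  refine (iInf_le _ fun s => if hs : ∀ i, 0 < s i then B s hs else fun _ => 0).trans
    (iInf₂_le_of_le r ?_ le_rfl)
  intro s hs l hl
  rw [makespan_assignment_le_iff hs]
  intro i
  simpa [hs] using hB s hs l hl le_top i

theorem le_optimalRatio [NeZero m] {r : ℝ≥0} {N : ℕ∞} {q : Fin m → ℝ} (hq : ∀ i, 0 < q i)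
    (h : ¬ SafeUpTo N q r [] 0) : (r : ℝ≥0∞) ≤ optimalRatio m := by
  refine le_iInf fun A => le_iInf₂ fun ρ hρ => ?_
  by_contra hlt
  have hlt' : (ρ : ℝ) ≤ r := by exact_mod_cast (not_le.1 hlt).le
  refine h (SafeUpTo.mono_ratio hq hlt' ⟨A q, fun f hf _ i => ?_⟩)
  simpa using (makespan_assignment_le_iff hq A f _).1 (hρ q hq f hf) i

theorem one_le_optimalRatio [NeZero m] : 1 ≤ optimalRatio m := by
  refine le_iInf fun A => le_iInf₂ fun ρ hρ => ?_
  have h1 : ∀ i : Fin m, (0 : ℝ) < (fun _ => 1) i := fun _ => one_pos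
  have h2 := hρ (fun _ => 1) h1 [1] (by simp)
  have h3 := opt_le_makespan (fun _ => 1) [1] (A.assignment (fun _ => 1) [1])
  have h4 : (0 : ℝ) < opt (fun _ : Fin m => (1 : ℝ)) [1] := by
    have := sum_le_mul_opt h1 [1]
    by_contra hlt
    have h5 : (∑ _i : Fin m, (1 : ℝ)) * opt (fun _ : Fin m => (1 : ℝ)) [1] ≤ 0 :=
      mul_nonpos_of_nonneg_of_nonpos (by positivity) (not_lt.1 hlt)
    simp only [List.sum_cons, List.sum_nil] at this
    norm_num at this h5
    linarith
  have h5 : (1 : ℝ) ≤ ρ := by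
    by_contra hlt
    nlinarith
  exact_mod_cast h5

theorem competitiveRatio_le [NeZero m] {A : OnlineAlg m} {r x ρ : ℝ≥0} (hρ : r * (1 + x) ≤ ρ)
    (h : ∀ s : Fin m → ℝ, (∀ i, 0 < s i) → ∃ q : Fin m → ℝ, (∀ i, 0 < q i) ∧ (∀ i, q i ≤ s i) ∧
      (∀ i, s i ≤ (1 + x) * q i) ∧ ∀ l : List ℕ, (∀ p ∈ l, 1 ≤ p) →
        ∀ i, (stratLoad (A s) l i : ℝ) ≤ r * opt q l * q i) :
    A.competitiveRatio ≤ ρ := by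
  refine iInf₂_le_of_le ρ ?_ le_rfl
  intro s hs l hl
  obtain ⟨q, hq, hqs, hsq, hload⟩ := h s hs
  rw [makespan_assignment_le_iff hs]
  intro i
  have hO := opt_nonneg hs l
  have hOq := opt_nonneg hq l
  have hopt : opt q l ≤ (1 + x) * opt s l := by
    obtain ⟨w, hw, hle⟩ := exists_isLoad_le_opt hs l
    refine opt_le hq hw fun k => (hle k).trans ?_
    calc opt s l * s k ≤ opt s l * ((1 + x) * q k) := by have := hsq k; gcongr
      _ = _ := by ring
  have hρ' : (r : ℝ) * (1 + x) ≤ ρ := by exact_mod_cast hρ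
  calc (stratLoad (A s) l i : ℝ) ≤ r * opt q l * q i := hload l hl i
    _ ≤ r * ((1 + x) * opt s l) * s i := by have := hqs i; have := (hq i).le; gcongr
    _ = r * (1 + x) * opt s l * s i := by ring
    _ ≤ ρ * opt s l * s i := by have := (hs i).le; gcongr

/-! ### Finite strategy tables and decidable tests. -/

/-- The `j`-th digit of `t` in base `m`. -/
def digit (m t j : ℕ) : ℕ := t / m ^ j % m

theorem digit_lt {m : ℕ} (hm : 0 < m) (t j : ℕ) : digit m t j < m := Nat.mod_lt _ hm

/-- Turns quantification over finite functions (assignments, strategy tables, grid points) into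
bounded quantification over numbers. -/
theorem exists_digits {m : ℕ} (C : ℕ) (B : ℕ → ℕ) (hB : ∀ j, B j < m) :
    ∃ t < m ^ C, ∀ j < C, digit m t j = B j := by
  have hm : 0 < m := (Nat.zero_le _).trans_lt (hB 0)
  induction C generalizing B with
  | zero => exact ⟨0, by simp, by simp⟩
  | succ C ih =>
    obtain ⟨t, ht, hd⟩ := ih (fun j => B (j + 1)) fun j => hB (j + 1)
    refine ⟨B 0 + m * t, ?_, fun j hj => ?_⟩
    · have h1 := hB 0
      have h2 : m * (t + 1) ≤ m * m ^ C := Nat.mul_le_mul_left _ ht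
      rw [pow_succ']
      linarith
    · rcases j with _ | j
      · simp [digit, Nat.mod_eq_of_lt (hB 0)]
      · rw [← hd j (by omega), digit, digit, pow_succ', ← Nat.div_div_eq_div_mul,
          Nat.add_mul_div_left _ _ hm, Nat.div_eq_of_lt (hB 0), zero_add]

/-- The online strategy with table `t`: machine numbers are stored as digits in base `m`. -/
def tableStrategy (m t : ℕ) (f : List ℕ) : ℕ := digit m t (Encodable.encode f)

/-- The test whether the strategy with table `t` keeps the ratio `r` at the continuation `f`. -/
def RatioTest (qs : List (ℕ × ℕ)) (l w : List ℕ) (r : ℕ × ℕ) (t : ℕ) (f : List ℕ) : Prop :=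
  ∀ i < qs.length, ∀ τ < qs.length ^ (l ++ f).length, ∃ k < qs.length,
    (w.getD i 0 + stratLoad (tableStrategy qs.length t) f i) *
        ((qs.getD k (0, 0)).1 * (qs.getD i (0, 0)).2 * r.2) ≤
      asgLoad (l ++ f) (digit qs.length τ) k *
        ((qs.getD i (0, 0)).1 * (qs.getD k (0, 0)).2 * r.1)

/-- The test whether some strategy keeps the ratio `r` for all continuations with codes below
`C`. -/
def TableTest (qs : List (ℕ × ℕ)) (l w : List ℕ) (r : ℕ × ℕ) (C : ℕ) : Prop :=
  ∃ t < qs.length ^ C, ∀ j < C, (∀ p ∈ Denumerable.ofNat (List ℕ) j, 1 ≤ p) →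
    RatioTest qs l w r t (Denumerable.ofNat (List ℕ) j)

/-- A bound on the codes of lists of length at most `k` with entries at most `N`. -/
def codeBound (N k : ℕ) : ℕ := Nat.rec 0 (fun _ c => Nat.succ (Nat.pair N c)) k

theorem pair_le_pair {a b c d : ℕ} (h₁ : a ≤ c) (h₂ : b ≤ d) : Nat.pair a b ≤ Nat.pair c d :=
  (StrictMono.monotone (fun _ _ h => Nat.pair_lt_pair_left b h) h₁).trans
    (StrictMono.monotone (fun _ _ h => Nat.pair_lt_pair_right c h) h₂)

theorem encode_le_codeBound {N k : ℕ} {f : List ℕ} (hk : f.length ≤ k) (hN : ∀ p ∈ f, p ≤ N) :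
    Encodable.encode f ≤ codeBound N k := by
  induction k generalizing f with
  | zero =>
    rw [List.length_eq_zero_iff.1 (Nat.le_zero.1 hk)]
    exact Nat.zero_le _
  | succ k ih =>
    rcases f with _ | ⟨p, f⟩
    · exact Nat.zero_le _
    · rw [Encodable.encode_list_cons]
      exact Nat.succ_le_succ (pair_le_pair (hN p (by simp))
        (ih (by simpa using hk) fun p hp => hN p (by simp [hp])))

theorem encode_take_le (f : List ℕ) (n : ℕ) :
    Encodable.encode (f.take n) ≤ Encodable.encode f := by
  induction f generalizing n with
  | nil => simp
  | cons p f ih =>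
    rcases n with _ | n
    · exact Nat.zero_le _
    · rw [List.take_succ_cons, Encodable.encode_list_cons, Encodable.encode_list_cons]
      exact Nat.succ_le_succ (pair_le_pair le_rfl (ih n))

theorem length_le_sum {f : List ℕ} (hf : ∀ p ∈ f, 1 ≤ p) : f.length ≤ f.sum := by
  simpa using List.card_nsmul_le_sum f 1 hf

theorem encode_le_of_sum_le {f : List ℕ} (hf : ∀ p ∈ f, 1 ≤ p) {N : ℕ} (hN : f.sum ≤ N) :
    Encodable.encode f ≤ codeBound N N :=
  encode_le_codeBound ((length_le_sum hf).trans hN) fun _ hp =>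
    (List.single_le_sum (by simp) _ hp).trans hN

section Spec

variable [NeZero m] {q : Fin m → ℕ × ℕ} {qs : List (ℕ × ℕ)} {l ws : List ℕ} {w : Fin m → ℕ}
  {r : ℕ × ℕ}

theorem frac_pos_iff {x : ℕ × ℕ} : 0 < frac x ↔ 0 < x.1 ∧ 0 < x.2 := by
  rw [frac, pos_iff_ne_zero, div_ne_zero_iff]
  simp [pos_iff_ne_zero]

theorem coe_frac (x : ℕ × ℕ) : (frac x : ℝ) = x.1 / x.2 := by simp [frac]

/-- The assignment whose machine numbers are the digits of `t`. -/
def digitAsg (m t : ℕ) [NeZero m] (j : ℕ) : Fin m := ⟨digit m t j, digit_lt (NeZero.pos m) t j⟩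

theorem asgLoad_digit (t : ℕ) (l : List ℕ) (i : Fin m) :
    asgLoad l (digit m t) i = asgLoad l (digitAsg m t) i :=
  asgLoad_comp_injective Fin.val_injective l (digitAsg m t) i

theorem stratLoad_table (t : ℕ) (f : List ℕ) (i : Fin m) :
    stratLoad (tableStrategy m t) f i =
      stratLoad (fun g => digitAsg m t (Encodable.encode g)) f i :=
  asgLoad_comp_injective Fin.val_injective f
    (fun j => digitAsg m t (Encodable.encode (f.take (j + 1)))) i

theorem isLoad_iff_digit {u : Fin m → ℕ} :
    IsLoad l u ↔ ∃ τ < m ^ l.length, ∀ i, u i = asgLoad l (digit m τ) i := by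
  constructor
  · rintro ⟨σ, hσ⟩
    obtain ⟨τ, hτ, hd⟩ := exists_digits l.length (fun j => (σ j : ℕ)) fun j => (σ j).2
    refine ⟨τ, hτ, fun i => ?_⟩
    rw [hσ, asgLoad_digit]
    exact asgLoad_congr (fun j hj => Fin.ext (hd j hj).symm) i
  · rintro ⟨τ, -, h⟩
    exact ⟨digitAsg m τ, fun i => by rw [h, asgLoad_digit]⟩

theorem ratioTest_iff (hlen : qs.length = m) (hqs : ∀ i : Fin m, qs.getD i (0, 0) = q i)
    (hws : ∀ i : Fin m, ws.getD i 0 = w i) (hq : ∀ i, 0 < frac (q i)) (hr : 0 < frac r)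
    (t : ℕ) (f : List ℕ) :
    RatioTest qs l ws r t f ↔ ∀ i,
      ((w i + stratLoad (fun g => digitAsg m t (Encodable.encode g)) f i : ℕ) : ℝ) ≤
        frac r * opt (fun i => (frac (q i) : ℝ)) (l ++ f) * frac (q i) := by
  subst hlen
  have hqr : ∀ i, 0 < (frac (q i) : ℝ) := fun i => by exact_mod_cast hq i
  have hrr : 0 < (frac r : ℝ) := by exact_mod_cast hr
  have hcross : ∀ (x y : ℕ) (i k : Fin qs.length),
      x * ((q k).1 * (q i).2 * r.2) ≤ y * ((q i).1 * (q k).2 * r.1) ↔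
        (x : ℝ) / (frac r * frac (q i)) * frac (q k) ≤ y := by
    intro x y i k
    obtain ⟨hr1, hr2⟩ := frac_pos_iff.1 hr
    obtain ⟨hi1, hi2⟩ := frac_pos_iff.1 (hq i)
    obtain ⟨hk1, hk2⟩ := frac_pos_iff.1 (hq k)
    have hr1' : (0 : ℝ) < r.1 := by exact_mod_cast hr1
    have hr2' : (0 : ℝ) < r.2 := by exact_mod_cast hr2
    have hi1' : (0 : ℝ) < (q i).1 := by exact_mod_cast hi1
    have hi2' : (0 : ℝ) < (q i).2 := by exact_mod_cast hi2
    have hk1' : (0 : ℝ) < (q k).1 := by exact_mod_cast hk1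
    have hk2' : (0 : ℝ) < (q k).2 := by exact_mod_cast hk2
    rw [coe_frac, coe_frac, coe_frac]
    have h1 : (x : ℝ) / (r.1 / r.2 * ((q i).1 / (q i).2)) * ((q k).1 / (q k).2) =
        x * ((q k).1 * (q i).2 * r.2) / ((q i).1 * (q k).2 * r.1) := by
      field_simp
    rw [h1, div_le_iff₀ (by positivity)]
    norm_cast
  have hmain : ∀ (i : Fin qs.length) (x : ℕ),
      (x : ℝ) ≤ frac r * opt (fun i => (frac (q i) : ℝ)) (l ++ f) * frac (q i) ↔
        ∀ τ < qs.length ^ (l ++ f).length, ∃ k : Fin qs.length,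
          x * ((q k).1 * (q i).2 * r.2) ≤
            asgLoad (l ++ f) (digit qs.length τ) k * ((q i).1 * (q k).2 * r.1) := by
    intro i x
    rw [mul_right_comm, ← div_le_iff₀' (mul_pos hrr (hqr i)), le_opt_iff hqr]
    constructor
    · intro h τ hτ
      obtain ⟨k, hk⟩ := h _ (isLoad_iff_digit.2 ⟨τ, hτ, fun _ => rfl⟩)
      exact ⟨k, (hcross _ _ _ _).2 hk⟩
    · intro h u hu
      obtain ⟨τ, hτ, hu⟩ := isLoad_iff_digit.1 hu
      obtain ⟨k, hk⟩ := h τ hτ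
      exact ⟨k, by rw [hu]; exact (hcross _ _ _ _).1 hk⟩
  simp only [hmain]
  rw [RatioTest]
  constructor
  · intro h i τ hτ
    obtain ⟨k, hk, hle⟩ := h i i.2 τ hτ
    refine ⟨⟨k, hk⟩, ?_⟩
    rw [← hqs, ← hqs, ← hws, ← stratLoad_table]
    exact hle
  · intro h i hi τ hτ
    obtain ⟨k, hle⟩ := h ⟨i, hi⟩ τ hτ
    refine ⟨k, k.2, ?_⟩
    rw [← hqs, ← hqs, ← hws, ← stratLoad_table] at hle
    exact hle

theorem safeUpTo_of_tableTest (hlen : qs.length = m)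
    (hqs : ∀ i : Fin m, qs.getD i (0, 0) = q i) (hws : ∀ i : Fin m, ws.getD i 0 = w i)
    (hq : ∀ i, 0 < frac (q i)) (hr : 0 < frac r) {C N : ℕ} (hC : codeBound N N < C)
    (h : TableTest qs l ws r C) : SafeUpTo N (fun i => (frac (q i) : ℝ)) (frac r) l w := by
  obtain ⟨t, -, ht⟩ := h
  refine ⟨fun g => digitAsg m t (Encodable.encode g), fun f hf hN => ?_⟩
  have hsum : l.sum + f.sum ≤ N := by exact_mod_cast hN
  have hcode : Encodable.encode f < C :=
    (encode_le_of_sum_le hf ((Nat.le_add_left _ _).trans hsum)).trans_lt hC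
  have := ht _ hcode
  rw [Denumerable.ofNat_encode] at this
  exact (ratioTest_iff hlen hqs hws hq hr t f).1 (this hf)

/-- A table holding the decisions for codes below `C` determines every load along a list coded below
`C`, because prefixes have no larger codes (`encode_take_le`). -/
theorem tableTest_of_safe (hlen : qs.length = m)
    (hqs : ∀ i : Fin m, qs.getD i (0, 0) = q i) (hws : ∀ i : Fin m, ws.getD i 0 = w i)
    (hq : ∀ i, 0 < frac (q i)) (hr : 0 < frac r) (C : ℕ)
    (h : Safe (fun i => (frac (q i) : ℝ)) (frac r) l w) : TableTest qs l ws r C := by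
  obtain ⟨B, hB⟩ := h
  obtain ⟨t, ht, hd⟩ := exists_digits C
    (fun j => ((B (Denumerable.ofNat (List ℕ) j) : Fin m) : ℕ)) fun j => Fin.is_lt _
  refine ⟨t, hlen ▸ ht, fun j hj hf => (ratioTest_iff hlen hqs hws hq hr t _).2 fun i => ?_⟩
  have h1 : stratLoad (fun g => digitAsg m t (Encodable.encode g)) (Denumerable.ofNat _ j) i =
      stratLoad B (Denumerable.ofNat _ j) i := by
    refine asgLoad_congr (fun n _ => Fin.ext ?_) i
    have h2 := encode_take_le (Denumerable.ofNat (List ℕ) j) (n + 1)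
    rw [Denumerable.encode_ofNat] at h2
    have h3 := hd _ (h2.trans_lt hj)
    rw [Denumerable.ofNat_encode] at h3
    exact h3
  rw [h1]
  exact hB _ hf le_top i

/-- A bound on the ratio of the sum of the speeds to any one of them. -/
def speedBound (qs : List (ℕ × ℕ)) : ℕ := (qs.map Prod.fst).sum * (qs.map Prod.snd).sum

/-- The sum of the speeds is at most the sum of the numerators, and each speed times the sum of the
denominators is at least `1`. -/
theorem sum_le_speedBound (hlen : qs.length = m)
    (hqs : ∀ i : Fin m, qs.getD i (0, 0) = q i) (hq : ∀ i, 0 < frac (q i)) (i : Fin m) :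
    ∑ k, (frac (q k) : ℝ) ≤ (speedBound qs : ℝ) * frac (q i) := by
  have hsum : ∀ g : ℕ × ℕ → ℕ, (qs.map g).sum = ∑ k, g (q k) := by
    intro g
    subst hlen
    have : q = fun i => qs.get i := by
      funext i
      rw [← hqs]
      simp
    rw [this, ← List.sum_ofFn]
    congr 1
    apply List.ext_get <;> simp
  rw [speedBound, hsum, hsum]
  have hn : ∀ k, (frac (q k) : ℝ) ≤ (q k).1 := fun k => by
    rw [coe_frac]
    have h1 : (1 : ℝ) ≤ (q k).2 := by exact_mod_cast (frac_pos_iff.1 (hq k)).2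
    exact div_le_self (Nat.cast_nonneg _) h1
  have hi : 1 ≤ ((∑ k, (q k).2 : ℕ) : ℝ) * frac (q i) := by
    obtain ⟨hi1, hi2⟩ := frac_pos_iff.1 (hq i)
    have h1 : (1 : ℝ) ≤ (q i).1 := by exact_mod_cast hi1
    have h2 : (0 : ℝ) < (q i).2 := by exact_mod_cast hi2
    have h3 : ((q i).2 : ℝ) ≤ ((∑ k, (q k).2 : ℕ) : ℝ) := by
      exact_mod_cast Finset.single_le_sum (f := fun k => (q k).2) (fun _ _ => Nat.zero_le _)
        (Finset.mem_univ i)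
    rw [coe_frac, ← mul_div_assoc, le_div_iff₀ h2]
    nlinarith
  have h4 : (∑ k, (frac (q k) : ℝ)) ≤ ((∑ k, (q k).1 : ℕ) : ℝ) := by
    push_cast
    exact Finset.sum_le_sum fun k _ => hn k
  rw [Nat.cast_mul, mul_assoc]
  exact h4.trans (le_mul_of_one_le_right (Nat.cast_nonneg _) hi)

/-- The bound on the codes of continuations up to which a strategy has to be checked in order to
be extendable with a loss of `1 + 1 / Z`. -/
def stepBound (qs : List (ℕ × ℕ)) (l : List ℕ) (Z : ℕ) : ℕ :=
  (fun N => codeBound N N + 1)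
    (horizon qs.length (33 * speedBound qs * Z + (8 * qs.length + 4)) l.sum)

/-- The decidable test for the state with jobs `l` and loads `ws`: it is passed if the ratio `r`
can be kept forever, and if it is passed then the ratio `r * (1 + 1 / Z)` can be kept forever. -/
def StepTest (qs : List (ℕ × ℕ)) (l ws : List ℕ) (r : ℕ × ℕ) (Z : ℕ) : Prop :=
  TableTest qs l ws r (stepBound qs l Z)

theorem stepTest_of_safe (hlen : qs.length = m)
    (hqs : ∀ i : Fin m, qs.getD i (0, 0) = q i) (hws : ∀ i : Fin m, ws.getD i 0 = w i)
    (hq : ∀ i, 0 < frac (q i)) (hr : 0 < frac r) (Z : ℕ)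
    (h : Safe (fun i => (frac (q i) : ℝ)) (frac r) l w) : StepTest qs l ws r Z :=
  tableTest_of_safe hlen hqs hws hq hr _ h

theorem safe_of_stepTest (hlen : qs.length = m)
    (hqs : ∀ i : Fin m, qs.getD i (0, 0) = q i) (hws : ∀ i : Fin m, ws.getD i 0 = w i)
    (hq : ∀ i, 0 < frac (q i)) (hr : 1 ≤ frac r) {Z : ℕ} (hZ : 1 ≤ Z)
    (hw : ∀ i, w i ≤ l.sum) (h : StepTest qs l ws r Z) :
    Safe (fun i => (frac (q i) : ℝ)) (frac r * (1 + 1 / Z)) l w := by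
  have hqr : ∀ i, 0 < (frac (q i) : ℝ) := fun i => by exact_mod_cast hq i
  have h1 := safeUpTo_of_tableTest hlen hqs hws hq (one_pos.trans_le hr) (Nat.lt_succ_self _) h
  rw [hlen] at h1
  have h2 := safe_of_safeUpTo hqr (by exact_mod_cast hr) (sum_le_speedBound hlen hqs hq)
    (Nat.le_add_left _ _) hw h1
  refine SafeUpTo.mono_ratio hqr
    (mul_le_mul_of_nonneg_left (add_le_add le_rfl ?_) (NNReal.coe_nonneg _)) h2
  have hZ' : (0 : ℝ) < Z := by exact_mod_cast hZ
  -- The precision in `stepBound` contains `33 * speedBound qs * Z`, so the truncation loss is at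
  -- most `1 / Z`.
  rw [div_le_div_iff₀ (by positivity) hZ']
  push_cast
  nlinarith

end Spec

/-! ### Primitive recursiveness of the tests. -/

section Primrec

open Primrec

variable {α : Type*} [Primcodable α]

theorem primrecPred_forall_lt {n : α → ℕ} {R : ℕ → α → Prop} (hn : Primrec n)
    (hR : PrimrecRel R) : PrimrecPred fun a => ∀ x < n a, R x a :=
  ((PrimrecRel.forall_mem_list hR).comp (list_range.comp hn) Primrec.id).of_eq (by simp)

theorem primrecPred_exists_lt {n : α → ℕ} {R : ℕ → α → Prop} (hn : Primrec n)
    (hR : PrimrecRel R) : PrimrecPred fun a => ∃ x < n a, R x a :=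
  ((PrimrecRel.exists_mem_list hR).comp (list_range.comp hn) Primrec.id).of_eq (by simp)

theorem primrec_sum_range {n : α → ℕ} {g : α → ℕ → ℕ} (hn : Primrec n) (hg : Primrec₂ g) :
    Primrec fun a => ∑ j ∈ Finset.range (n a), g a j := by
  refine (nat_rec' hn (.const 0) (h := fun a p => p.2 + g a p.1)
    (nat_add.comp₂ (snd.comp₂ Primrec₂.right) (hg.comp₂ Primrec₂.left
      (fst.comp₂ Primrec₂.right)))).of_eq fun a => ?_
  induction n a with
  | zero => rfl
  | succ n ih => rw [Finset.sum_range_succ, ← ih]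

theorem primrec_pow : Primrec₂ ((· ^ ·) : ℕ → ℕ → ℕ) :=
  Primrec₂.unpaired'.1 Nat.Primrec.pow

theorem primrec_list_sum : Primrec (List.sum : List ℕ → ℕ) :=
  (list_foldr Primrec.id (.const 0) (h := fun _ p => p.1 + p.2)
    (nat_add.comp₂ (fst.comp₂ Primrec₂.right) (snd.comp₂ Primrec₂.right))).of_eq fun _ => rfl

theorem primrec_digit {m t j : α → ℕ} (hm : Primrec m) (ht : Primrec t) (hj : Primrec j) :
    Primrec fun a => digit (m a) (t a) (j a) :=
  nat_mod.comp (nat_div.comp ht (primrec_pow.comp hm hj)) hm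

theorem primrec_asgLoad {l : α → List ℕ} {σ : α → ℕ → ℕ} {i : α → ℕ} (hl : Primrec l)
    (hσ : Primrec₂ σ) (hi : Primrec i) : Primrec fun a => asgLoad (l a) (σ a) (i a) :=
  primrec_sum_range (list_length.comp hl)
    (Primrec.ite (Primrec.eq.comp hσ (hi.comp fst))
      ((list_getD 0).comp (hl.comp fst) snd) (.const 0))

theorem primrec_stratLoad_table {m t i : α → ℕ} {f : α → List ℕ} (hm : Primrec m)
    (ht : Primrec t) (hf : Primrec f) (hi : Primrec i) :
    Primrec fun a => stratLoad (tableStrategy (m a) (t a)) (f a) (i a) :=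
  primrec_asgLoad hf (primrec_digit (hm.comp fst) (ht.comp fst)
    (Primrec.encode.comp (list_take.comp (succ.comp snd) (hf.comp fst)))) hi

theorem primrec_getD_fst {qs : α → List (ℕ × ℕ)} {i : α → ℕ} (hqs : Primrec qs)
    (hi : Primrec i) : Primrec fun a => ((qs a).getD (i a) (0, 0)).1 :=
  fst.comp ((list_getD (0, 0)).comp hqs hi)

theorem primrec_getD_snd {qs : α → List (ℕ × ℕ)} {i : α → ℕ} (hqs : Primrec qs)
    (hi : Primrec i) : Primrec fun a => ((qs a).getD (i a) (0, 0)).2 :=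
  snd.comp ((list_getD (0, 0)).comp hqs hi)

variable {qs : α → List (ℕ × ℕ)} {l w : α → List ℕ} {r : α → ℕ × ℕ}

theorem primrecPred_ratioTest {t : α → ℕ} {f : α → List ℕ} (hqs : Primrec qs) (hl : Primrec l)
    (hw : Primrec w) (hr : Primrec r) (ht : Primrec t) (hf : Primrec f) :
    PrimrecPred fun a => RatioTest (qs a) (l a) (w a) (r a) (t a) (f a) := by
  have hm : Primrec fun a => (qs a).length := list_length.comp hqs
  have hlf : Primrec fun a => l a ++ f a := list_append.comp hl hf
  refine primrecPred_forall_lt hm (primrecPred_forall_lt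
    (primrec_pow.comp (hm.comp snd) (list_length.comp (hlf.comp snd)))
    (primrecPred_exists_lt (hm.comp (snd.comp snd)) ?_))
  have ha : Primrec fun x : ℕ × ℕ × ℕ × α => x.2.2.2 := snd.comp (snd.comp snd)
  have hi : Primrec fun x : ℕ × ℕ × ℕ × α => x.2.2.1 := fst.comp (snd.comp snd)
  have hτ : Primrec fun x : ℕ × ℕ × ℕ × α => x.2.1 := fst.comp snd
  have hk : Primrec fun x : ℕ × ℕ × ℕ × α => x.1 := fst
  refine nat_le.comp (nat_mul.comp (nat_add.comp ((list_getD 0).comp (hw.comp ha) hi)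
      (primrec_stratLoad_table (hm.comp ha) (ht.comp ha) (hf.comp ha) hi))
      (nat_mul.comp (nat_mul.comp (primrec_getD_fst (hqs.comp ha) hk)
        (primrec_getD_snd (hqs.comp ha) hi)) (snd.comp (hr.comp ha))))
    (nat_mul.comp (primrec_asgLoad (hlf.comp ha)
      (primrec_digit (hm.comp (ha.comp fst)) (hτ.comp fst) snd) hk)
      (nat_mul.comp (nat_mul.comp (primrec_getD_fst (hqs.comp ha) hi)
        (primrec_getD_snd (hqs.comp ha) hk)) (fst.comp (hr.comp ha))))

theorem primrecPred_forall_pos : PrimrecPred fun f : List ℕ => ∀ p ∈ f, 1 ≤ p :=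
  PrimrecPred.forall_mem_list (nat_le.comp (.const 1) Primrec.id)

theorem primrecPred_tableTest {C : α → ℕ} (hqs : Primrec qs) (hl : Primrec l) (hw : Primrec w)
    (hr : Primrec r) (hC : Primrec C) :
    PrimrecPred fun a => TableTest (qs a) (l a) (w a) (r a) (C a) := by
  have hm : Primrec fun a => (qs a).length := list_length.comp hqs
  have ha : Primrec fun x : ℕ × ℕ × α => x.2.2 := snd.comp snd
  have hj : Primrec fun x : ℕ × ℕ × α => Denumerable.ofNat (List ℕ) x.1 :=
    (Primrec.ofNat _).comp fst
  refine primrecPred_exists_lt (primrec_pow.comp hm hC) (primrecPred_forall_lt (hC.comp snd) ?_)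
  refine PrimrecPred.of_eq (((primrecPred_forall_pos.comp hj).not).or
    (primrecPred_ratioTest (hqs.comp ha) (hl.comp ha) (hw.comp ha) (hr.comp ha)
      (fst.comp snd) hj)) fun x => imp_iff_not_or.symm

theorem primrec_codeBound : Primrec₂ codeBound :=
  nat_rec (.const 0) (succ.comp₂ (Primrec₂.natPair.comp₂ Primrec₂.left
    (snd.comp₂ Primrec₂.right)))

theorem primrec_horizon {m D X : α → ℕ} (hm : Primrec m) (hD : Primrec D) (hX : Primrec X) :
    Primrec fun a => horizon (m a) (D a) (X a) := by
  have hc : ∀ n : ℕ, Primrec fun _ : α => n := fun n => .const n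
  have hD1 : Primrec fun a => (D a + 1) ^ m a :=
    primrec_pow.comp (nat_add.comp hD (hc 1)) hm
  exact nat_mul.comp (nat_add.comp (nat_mul.comp (hc 2) (primrec_pow.comp hD (hc 3)))
    (nat_mul.comp hD hX)) (primrec_pow.comp (nat_add.comp (nat_mul.comp (hc 2) hD) (hc 2))
      (nat_add.comp (nat_mul.comp hD1 (primrec_pow.comp (hc 2) hD1)) (hc 2)))

theorem primrec_speedBound : Primrec speedBound :=
  nat_mul.comp (primrec_list_sum.comp (list_map Primrec.id (fst.comp₂ Primrec₂.right)))
    (primrec_list_sum.comp (list_map Primrec.id (snd.comp₂ Primrec₂.right)))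

theorem primrec_stepBound {Z : α → ℕ} (hqs : Primrec qs) (hl : Primrec l) (hZ : Primrec Z) :
    Primrec fun a => stepBound (qs a) (l a) (Z a) := by
  have hm : Primrec fun a => (qs a).length := list_length.comp hqs
  have hc : ∀ n : ℕ, Primrec fun _ : α => n := fun n => .const n
  have hN := primrec_horizon hm (nat_add.comp (nat_mul.comp (nat_mul.comp (hc 33)
    (primrec_speedBound.comp hqs)) hZ) (nat_add.comp (nat_mul.comp (hc 8) hm) (hc 4)))
    (primrec_list_sum.comp hl)
  exact nat_add.comp (primrec_codeBound.comp hN hN) (hc 1)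

theorem primrecPred_stepTest {Z : α → ℕ} (hqs : Primrec qs) (hl : Primrec l) (hw : Primrec w)
    (hr : Primrec r) (hZ : Primrec Z) :
    PrimrecPred fun a => StepTest (qs a) (l a) (w a) (r a) (Z a) :=
  primrecPred_tableTest hqs hl hw hr (primrec_stepBound hqs hl hZ)

end Primrec

/-! ### The program and the search on the grid. -/

/-- The loads `w` of `m` machines after a job of size `p` has been put on machine `i`. -/
def addJob (m : ℕ) (w : List ℕ) (i p : ℕ) : List ℕ :=
  (List.range m).map fun k => w.getD k 0 + if i = k then p else 0

theorem addJob_getD {m : ℕ} (w : List ℕ) (i p : ℕ) (k : Fin m) :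
    (addJob m w i p).getD k 0 = w.getD k 0 + if i = (k : ℕ) then p else 0 := by
  simp [addJob, List.getD_eq_getElem?_getD]

open Classical in
/-- The first machine such that the ratio `r` can be kept, according to the test with slack
`1 / Z`, if the new job `p` is put there. -/
noncomputable def nextMachine (qs : List (ℕ × ℕ)) (l w : List ℕ) (r : ℕ × ℕ) (Z p : ℕ) : ℕ :=
  (List.range qs.length).findIdx
    (fun i => decide (StepTest qs (l ++ [p]) (addJob qs.length w i p) r Z)) % qs.length

/-- The reduction modulo the number of machines gives a valid output even if no machine passes the
test. This matters because the program must answer on every list, including those with jobs of size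
zero. -/
theorem nextMachine_lt {qs : List (ℕ × ℕ)} (h : 0 < qs.length) (l w : List ℕ) (r : ℕ × ℕ)
    (Z p : ℕ) : nextMachine qs l w r Z p < qs.length :=
  Nat.mod_lt _ h

theorem stepTest_nextMachine {qs : List (ℕ × ℕ)} {l w : List ℕ} {r : ℕ × ℕ} {Z p : ℕ}
    (h : ∃ i < qs.length, StepTest qs (l ++ [p]) (addJob qs.length w i p) r Z) :
    StepTest qs (l ++ [p]) (addJob qs.length w (nextMachine qs l w r Z p) p) r Z := by
  classical
  obtain ⟨i, hi, ht⟩ := h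
  have hlt : (List.range qs.length).findIdx
      (fun i => decide (StepTest qs (l ++ [p]) (addJob qs.length w i p) r Z)) <
        (List.range qs.length).length :=
    List.findIdx_lt_length_of_exists ⟨i, List.mem_range.2 hi, decide_eq_true ht⟩
  have hget := List.findIdx_getElem (w := hlt)
  rw [List.getElem_range, decide_eq_true_eq] at hget
  rw [List.length_range] at hlt
  rw [nextMachine, Nat.mod_eq_of_lt (by convert hlt)]
  convert hget

/-- The ratio `(1 + 1 / Z) ^ 3 * (k / Z) * (1 + j / (Z * (j + 1)))` that the program keeps after
`j` jobs. -/
def stepRatio (Z k j : ℕ) : ℕ × ℕ :=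
  ((Z + 1) ^ 3 * k * (Z * (j + 1) + j), Z ^ 4 * (Z * (j + 1)))

/-- The precision of the test for the job number `j`. -/
def stepSlack (Z j : ℕ) : ℕ := 2 * Z * ((j + 1) * (j + 2))

/-- The state of the program: the jobs so far, their loads, and the machine of the last job. -/
noncomputable def nextState (x : (ℕ × ℕ) × List (ℕ × ℕ)) (s : List ℕ × List ℕ × ℕ) (p : ℕ) :
    List ℕ × List ℕ × ℕ :=
  (fun i => (s.1 ++ [p], addJob x.2.length s.2.1 i p, i))
    (nextMachine x.2 s.1 s.2.1 (stepRatio x.1.1 x.1.2 s.1.length)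
      (stepSlack x.1.1 s.1.length) p)

/-- The state of the program after the jobs of `l`. -/
noncomputable def run (x : (ℕ × ℕ) × List (ℕ × ℕ)) (l : List ℕ) : List ℕ × List ℕ × ℕ :=
  l.foldl (nextState x) ([], [], 0)

theorem run_append_singleton (x : (ℕ × ℕ) × List (ℕ × ℕ)) (l : List ℕ) (p : ℕ) :
    run x (l ++ [p]) = nextState x (run x l) p := by
  rw [run, List.foldl_append]; rfl

theorem run_fst (x : (ℕ × ℕ) × List (ℕ × ℕ)) (l : List ℕ) : (run x l).1 = l := by
  induction l using List.reverseRecOn with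
  | nil => rfl
  | append_singleton l p ih => rw [run_append_singleton, nextState, ih]

theorem run_lt {x : (ℕ × ℕ) × List (ℕ × ℕ)} (h : 0 < x.2.length) (l : List ℕ) :
    (run x l).2.2 < x.2.length := by
  induction l using List.reverseRecOn with
  | nil => exact h
  | append_singleton l p ih =>
    rw [run_append_singleton]
    exact nextMachine_lt h _ _ _ _ _

/-- Speeds on the grid `{1, …, G} ^ m`. -/
def gridSpeeds (m G t : ℕ) : List (ℕ × ℕ) := (List.range m).map fun i => (digit G t i + 1, 1)

/-- The test of the ratio `k / Z` for all speeds on the grid. -/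
def GridTest (m Z k : ℕ) : Prop :=
  ∀ t < (m * Z ^ 2) ^ m, StepTest (gridSpeeds m (m * Z ^ 2) t) [] [] (k, Z) Z

open Classical in
/-- The first `k > Z` such that the ratio `k / Z` passes the test for all speeds on the grid. -/
noncomputable def firstRatio (m Z : ℕ) : ℕ :=
  Z + 1 + (List.range (m * Z)).findIdx fun i => decide (GridTest m Z (Z + 1 + i))

/-! ### Computability of the program and of the search. -/

section Primrec

open Primrec

variable {α : Type*} [Primcodable α]

theorem primrec_addJob {m i p : α → ℕ} {w : α → List ℕ} (hm : Primrec m) (hw : Primrec w)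
    (hi : Primrec i) (hp : Primrec p) : Primrec fun a => addJob (m a) (w a) (i a) (p a) :=
  list_map (list_range.comp hm) (nat_add.comp ((list_getD 0).comp (hw.comp fst) snd)
    (Primrec.ite (Primrec.eq.comp (hi.comp fst) snd) (hp.comp fst) (.const 0)))

theorem primrec_nextMachine {qs : α → List (ℕ × ℕ)} {l w : α → List ℕ} {r : α → ℕ × ℕ}
    {Z p : α → ℕ} (hqs : Primrec qs) (hl : Primrec l) (hw : Primrec w) (hr : Primrec r)
    (hZ : Primrec Z) (hp : Primrec p) :
    Primrec fun a => nextMachine (qs a) (l a) (w a) (r a) (Z a) (p a) := by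
  have hm : Primrec fun a => (qs a).length := list_length.comp hqs
  classical
  exact nat_mod.comp (list_findIdx (list_range.comp hm) (PrimrecPred.decide
    (primrecPred_stepTest (hqs.comp fst) (list_concat.comp (hl.comp fst) (hp.comp fst))
      (primrec_addJob (hm.comp fst) (hw.comp fst) snd (hp.comp fst)) (hr.comp fst)
      (hZ.comp fst)))) hm

theorem primrec_stepRatio {Z k j : α → ℕ} (hZ : Primrec Z) (hk : Primrec k) (hj : Primrec j) :
    Primrec fun a => stepRatio (Z a) (k a) (j a) := by
  have hZj : Primrec fun a => Z a * (j a + 1) := nat_mul.comp hZ (succ.comp hj)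
  exact (nat_mul.comp (nat_mul.comp (primrec_pow.comp (succ.comp hZ) (.const 3)) hk)
    (nat_add.comp hZj hj)).pair (nat_mul.comp (primrec_pow.comp hZ (.const 4)) hZj)

theorem primrec_stepSlack {Z j : α → ℕ} (hZ : Primrec Z) (hj : Primrec j) :
    Primrec fun a => stepSlack (Z a) (j a) :=
  nat_mul.comp (nat_mul.comp (.const 2) hZ)
    (nat_mul.comp (succ.comp hj) (nat_add.comp hj (.const 2)))

theorem primrec_nextState {x : α → (ℕ × ℕ) × List (ℕ × ℕ)} {s : α → List ℕ × List ℕ × ℕ}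
    {p : α → ℕ} (hx : Primrec x) (hs : Primrec s) (hp : Primrec p) :
    Primrec fun a => nextState (x a) (s a) (p a) := by
  have hZ := fst.comp (fst.comp hx)
  have hj := list_length.comp (fst.comp hs)
  have hw := fst.comp (snd.comp hs)
  have hi := primrec_nextMachine (snd.comp hx) (fst.comp hs) hw
    (primrec_stepRatio hZ (snd.comp (fst.comp hx)) hj) (primrec_stepSlack hZ hj) hp
  exact (list_concat.comp (fst.comp hs) hp).pair
    ((primrec_addJob (list_length.comp (snd.comp hx)) hw hi hp).pair hi)

theorem primrec_run : Primrec fun x : (ℕ × ℕ) × List (ℕ × ℕ) × List ℕ =>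
    (run (x.1, x.2.1) x.2.2).2.2 :=
  snd.comp (snd.comp (list_foldl (snd.comp snd) (.const ([], [], 0))
    (primrec_nextState ((fst.comp fst).pair (fst.comp (snd.comp fst))) (fst.comp snd)
      (snd.comp snd)).to₂))

theorem primrec_gridSpeeds {m G t : α → ℕ} (hm : Primrec m) (hG : Primrec G) (ht : Primrec t) :
    Primrec fun a => gridSpeeds (m a) (G a) (t a) :=
  list_map (list_range.comp hm)
    ((succ.comp (primrec_digit (hG.comp fst) (ht.comp fst) snd)).pair (.const 1))

theorem primrecPred_gridTest {m Z k : α → ℕ} (hm : Primrec m) (hZ : Primrec Z)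
    (hk : Primrec k) : PrimrecPred fun a => GridTest (m a) (Z a) (k a) := by
  have hG : Primrec fun a => m a * Z a ^ 2 := nat_mul.comp hm (primrec_pow.comp hZ (.const 2))
  exact primrecPred_forall_lt (primrec_pow.comp hG hm) (primrecPred_stepTest
    (primrec_gridSpeeds (hm.comp snd) (hG.comp snd) fst) (.const []) (.const [])
    ((hk.comp snd).pair (hZ.comp snd)) (hZ.comp snd))

theorem primrec_firstRatio {m Z : α → ℕ} (hm : Primrec m) (hZ : Primrec Z) :
    Primrec fun a => firstRatio (m a) (Z a) := by
  classical
  exact nat_add.comp (succ.comp hZ) (list_findIdx (list_range.comp (nat_mul.comp hm hZ))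
    (PrimrecPred.decide (primrecPred_gridTest (hm.comp fst) (hZ.comp fst)
      (nat_add.comp (succ.comp (hZ.comp fst)) snd))))

/-- One universal code serves all parameters; currying hardwires the precision and the ratio found
by the search. -/
theorem exists_runCode : ∃ c : Nat.Partrec.Code, ∀ (y : ℕ × ℕ) (qs : List (ℕ × ℕ)) (l : List ℕ),
    (c.curry (Encodable.encode y)).eval (Encodable.encode (qs, l)) =
      Part.some (run (y, qs) l).2.2 := by
  obtain ⟨c, hc⟩ := Nat.Partrec.Code.exists_code.1 primrec_run.to_comp
  refine ⟨c, fun y qs l => ?_⟩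
  rw [Nat.Partrec.Code.eval_curry, ← Encodable.encode_prod_val, hc]
  simp only [Encodable.encodek, Part.coe_some, Part.bind_some, PFun.coe_val, Part.map_some,
    Encodable.encode_nat]

end Primrec

/-! ### Correctness of the program and of the search. -/

section Spec

theorem stratLoad_run {x : (ℕ × ℕ) × List (ℕ × ℕ)} (hx : x.2.length = m) {B : List ℕ → Fin m}
    (hB : ∀ l, (B l : ℕ) = (run x l).2.2) (l : List ℕ) (i : Fin m) :
    stratLoad B l i = (run x l).2.1.getD i 0 := by
  induction l using List.reverseRecOn with
  | nil => simp [run]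
  | append_singleton l p ih =>
    rw [stratLoad_append_singleton, ih]
    have h1 := hB (l ++ [p])
    rw [run_append_singleton] at h1 ⊢
    simp only [nextState, hx, addJob_getD] at h1 ⊢
    rw [← h1]
    simp only [Fin.ext_iff]

theorem gridSpeeds_getD (G t : ℕ) (i : Fin m) :
    (gridSpeeds m G t).getD i (0, 0) = (digit G t i + 1, 1) := by
  simp [gridSpeeds, List.getD_eq_getElem?_getD]

variable [NeZero m]

theorem coe_frac_stepRatio {Z : ℕ} (hZ : 1 ≤ Z) (k j : ℕ) :
    (frac (stepRatio Z k j) : ℝ) = (1 + 1 / Z) ^ 3 * (k / Z) * (1 + j / (Z * (j + 1))) := by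
  have hZ' : (0 : ℝ) < Z := by exact_mod_cast hZ
  rw [coe_frac, stepRatio]
  push_cast
  field_simp

theorem one_le_frac_stepRatio {Z k : ℕ} (hZ : 1 ≤ Z) (hk : Z ≤ k) (j : ℕ) :
    1 ≤ frac (stepRatio Z k j) := by
  have hZ' : (0 : ℝ) < Z := by exact_mod_cast hZ
  have hk' : (1 : ℝ) ≤ k / Z := by rw [one_le_div hZ']; exact_mod_cast hk
  have h : (1 : ℝ) ≤ frac (stepRatio Z k j) := by
    rw [coe_frac_stepRatio hZ]
    have h1 : (1 : ℝ) ≤ (1 + 1 / Z) ^ 3 :=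
      one_le_pow₀ (le_add_of_nonneg_right (by positivity))
    have h2 : (1 : ℝ) ≤ 1 + j / (Z * (j + 1)) := le_add_of_nonneg_right (by positivity)
    exact one_le_mul_of_one_le_of_one_le (one_le_mul_of_one_le_of_one_le h1 hk') h2
  exact_mod_cast h

/-- The last factor of the ratio grows by `1 / (Z * ((j + 1) * (j + 2)))`, a telescoping series with
sum `1 / Z`. The slack is half this increment, which suffices because the factor itself is at most
`2`. -/
theorem frac_stepRatio_mul_le {Z : ℕ} (hZ : 1 ≤ Z) (k j : ℕ) :
    (frac (stepRatio Z k j) : ℝ) * (1 + 1 / stepSlack Z j) ≤ frac (stepRatio Z k (j + 1)) := by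
  have hZ' : (1 : ℝ) ≤ Z := by exact_mod_cast hZ
  rw [coe_frac_stepRatio hZ, coe_frac_stepRatio hZ, mul_assoc _ (1 + _ / _) (1 + _)]
  refine mul_le_mul_of_nonneg_left ?_ (by positivity)
  have h1 : (1 : ℝ) + (j + 1 : ℕ) / (Z * ((j + 1 : ℕ) + 1)) =
      1 + j / (Z * (j + 1)) + 1 / (Z * ((j + 1) * (j + 2))) := by
    push_cast
    field_simp
    ring
  have h2 : 1 + (j : ℝ) / (Z * (j + 1)) ≤ 2 := by
    have : (j : ℝ) / (Z * (j + 1)) ≤ 1 := by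
      rw [div_le_one (by positivity)]
      have : (0 : ℝ) ≤ j := by positivity
      nlinarith
    linarith
  have h3 : (1 : ℝ) / stepSlack Z j = 1 / (Z * ((j + 1) * (j + 2))) / 2 := by
    rw [stepSlack]
    push_cast
    field_simp
  rw [h1, h3, mul_add, mul_one]
  have : (0 : ℝ) ≤ 1 / (Z * ((j + 1) * (j + 2))) := by positivity
  nlinarith

theorem frac_stepRatio_le {Z : ℕ} (hZ : 1 ≤ Z) (k j : ℕ) :
    (frac (stepRatio Z k j) : ℝ) ≤ (1 + 1 / Z) ^ 4 * (k / Z) := by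
  have hZ' : (1 : ℝ) ≤ Z := by exact_mod_cast hZ
  rw [coe_frac_stepRatio hZ]
  have h1 : (j : ℝ) / (Z * (j + 1)) ≤ 1 / Z := by
    rw [div_le_div_iff₀ (by positivity) (by positivity)]
    nlinarith
  calc (1 + 1 / (Z : ℝ)) ^ 3 * (k / Z) * (1 + j / (Z * (j + 1)))
      ≤ (1 + 1 / (Z : ℝ)) ^ 3 * (k / Z) * (1 + 1 / Z) := by gcongr
    _ = _ := by ring

/-- The program keeps the loads below its current ratio. -/
theorem run_safe {q : Fin m → ℕ × ℕ} (hq : ∀ i, 0 < frac (q i)) {Z k : ℕ} (hZ : 1 ≤ Z)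
    (hk : Z ≤ k) (h0 : Safe (fun i => (frac (q i) : ℝ)) ((1 + 1 / Z) ^ 3 * (k / Z)) [] 0)
    {l : List ℕ} (hl : ∀ p ∈ l, 1 ≤ p) :
    (∀ i : Fin m, (run ((Z, k), List.ofFn q) l).2.1.getD i 0 ≤ l.sum) ∧
      Safe (fun i => (frac (q i) : ℝ)) (frac (stepRatio Z k l.length)) l
        (fun i : Fin m => (run ((Z, k), List.ofFn q) l).2.1.getD i 0) := by
  have hlen : (List.ofFn q).length = m := List.length_ofFn
  have hqs : ∀ i : Fin m, (List.ofFn q).getD i (0, 0) = q i := fun i => by simp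
  have hqr : ∀ i, 0 < (frac (q i) : ℝ) := fun i => by exact_mod_cast hq i
  induction l using List.reverseRecOn with
  | nil =>
    refine ⟨fun i => by simp [run], ?_⟩
    rw [coe_frac_stepRatio hZ, List.length_nil, Nat.cast_zero, zero_div, add_zero, mul_one]
    exact h0
  | append_singleton l p ih =>
    obtain ⟨ihle, ihsafe⟩ := ih fun p hp => hl p (by simp [hp])
    obtain ⟨i, hi⟩ := ihsafe.step (hl p (by simp))
    have hr := one_le_frac_stepRatio hZ hk l.length
    rw [run_append_singleton, nextState, run_fst]
    set w := (run ((Z, k), List.ofFn q) l).2.1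
    have htest := stepTest_nextMachine (qs := List.ofFn q) (l := l) (w := w) (p := p)
      (r := stepRatio Z k l.length) (Z := stepSlack Z l.length)
      ⟨i, by rw [hlen]; exact i.2, stepTest_of_safe hlen hqs
        (fun k => by rw [hlen, addJob_getD]; simp only [Fin.ext_iff]) hq (one_pos.trans_le hr) _ hi⟩
    refine ⟨fun k => ?_, ?_⟩
    · rw [hlen, addJob_getD, List.sum_append, List.sum_singleton]
      exact add_le_add (ihle k) (by split_ifs <;> omega)
    · have hslack : 1 ≤ stepSlack Z l.length := by
        rw [stepSlack]; exact Nat.succ_le_of_lt (by positivity)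
      have := safe_of_stepTest hlen hqs (fun _ => rfl) hq hr hslack (fun k => by
        rw [hlen, addJob_getD, List.sum_append, List.sum_singleton]
        exact add_le_add (ihle k) (by split_ifs <;> omega)) htest
      refine SafeUpTo.mono_ratio hqr ?_ this
      rw [List.length_append, List.length_singleton]
      exact frac_stepRatio_mul_le hZ k _

theorem stratLoad_run_le {q : Fin m → ℕ × ℕ} (hq : ∀ i, 0 < frac (q i)) {Z k : ℕ} (hZ : 1 ≤ Z)
    (hk : Z ≤ k) (h0 : Safe (fun i => (frac (q i) : ℝ)) ((1 + 1 / Z) ^ 3 * (k / Z)) [] 0)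
    {B : List ℕ → Fin m} (hB : ∀ l, (B l : ℕ) = (run ((Z, k), List.ofFn q) l).2.2)
    {l : List ℕ} (hl : ∀ p ∈ l, 1 ≤ p) (i : Fin m) :
    (stratLoad B l i : ℝ) ≤
      (1 + 1 / Z) ^ 4 * (k / Z) * opt (fun i => (frac (q i) : ℝ)) l * frac (q i) := by
  have hqr : ∀ i, 0 < (frac (q i) : ℝ) := fun i => by exact_mod_cast hq i
  have h1 := (run_safe hq hZ hk h0 hl).2.le i
  rw [stratLoad_run List.length_ofFn hB]
  refine h1.trans ?_
  have h2 := opt_nonneg hqr l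
  have h3 := frac_stepRatio_le hZ k l.length
  gcongr

theorem frac_natCast (n d : ℕ) : (frac (n, d) : ℝ) = n / d := coe_frac _

/-- One factor `1 + 1 / Z` is lost by truncation, two by passing to the grid. -/
theorem safe_of_gridTest {Z k : ℕ} (hZ : 1 ≤ Z) (hk : Z ≤ k) (h : GridTest m Z k)
    {s : Fin m → ℝ} (hs : ∀ i, 0 < s i) : Safe s ((1 + 1 / Z) ^ 3 * (k / Z)) [] 0 := by
  have hZ' : (0 : ℝ) < Z := by exact_mod_cast hZ
  have hG : 0 < m * Z ^ 2 := Nat.mul_pos (NeZero.pos m) (by positivity)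
  have key : Safe s ((k / Z) * (1 + 1 / Z) * (1 + 1 / Z) ^ 2) [] 0 := by
    refine safe_of_grid hZ (by positivity) (fun g hg => ?_) hs
    obtain ⟨t, ht, hd⟩ := exists_digits (m := m * Z ^ 2) m
      (fun j => if hj : j < m then g ⟨j, hj⟩ - 1 else 0) (fun j => by
        split_ifs with hj
        · have := hg ⟨j, hj⟩; omega
        · exact hG)
    have h1 := safe_of_stepTest (m := m) (q := fun i => (g i, 1)) (w := 0) (by simp [gridSpeeds])
      (fun i => by
        rw [gridSpeeds_getD, hd i i.2]
        have := hg i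
        simp only [Fin.is_lt, dif_pos, Fin.eta]
        congr 1
        omega)
      (fun i => by simp) (fun i => by
        have := (hg i).1
        rw [frac_pos_iff]
        exact ⟨this, one_pos⟩) (r := (k, Z)) (by
        have : (1 : ℝ) ≤ frac (k, Z) := by
          rw [frac_natCast, one_le_div hZ']; exact_mod_cast hk
        exact_mod_cast this) hZ (by simp) (h t ht)
    simpa [frac_natCast] using h1
  convert key using 1
  ring

theorem exists_not_safe_of_not_gridTest {Z k : ℕ} (hZ : 1 ≤ Z) (hk : Z ≤ k)
    (h : ¬ GridTest m Z k) :
    ∃ q : Fin m → ℝ, (∀ i, 0 < q i) ∧ ¬ Safe q (frac (k, Z)) [] 0 := by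
  rw [GridTest] at h
  push Not at h
  obtain ⟨t, ht, h⟩ := h
  have hpos : ∀ i : Fin m, 0 < frac (digit (m * Z ^ 2) t i + 1, 1) := fun i => by
    rw [frac_pos_iff]; exact ⟨Nat.succ_pos _, one_pos⟩
  refine ⟨fun i : Fin m => (frac (digit (m * Z ^ 2) t i + 1, 1) : ℝ),
    fun i => by exact_mod_cast hpos i, fun hsafe => h ?_⟩
  exact stepTest_of_safe (m := m) (q := fun i => (digit (m * Z ^ 2) t i + 1, 1)) (w := 0)
    (by simp [gridSpeeds]) (fun i => gridSpeeds_getD _ _ i) (fun i => by simp) hpos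
    (frac_pos_iff.2 ⟨by omega, by omega⟩) Z hsafe

/-- Putting all jobs on the fastest machine keeps the ratio `m`, so the ratio `m + 1` must pass.
This bounds the search by `m * Z` candidates. -/
theorem gridTest_mul {Z : ℕ} (hZ : 1 ≤ Z) : GridTest m Z ((m + 1) * Z) := by
  by_contra h
  obtain ⟨q, hq, hn⟩ := exists_not_safe_of_not_gridTest hZ (by nlinarith) h
  refine hn (SafeUpTo.mono_ratio hq ?_ (safe_card hq))
  have hZ' : (0 : ℝ) < Z := by exact_mod_cast hZ
  rw [frac_natCast, le_div_iff₀ hZ']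
  push_cast
  nlinarith

theorem gridTest_firstRatio {Z : ℕ} (hZ : 1 ≤ Z) : GridTest m Z (firstRatio m Z) := by
  classical
  have hm : 1 ≤ m := NeZero.one_le
  have hmZ : Z ≤ m * Z := Nat.le_mul_of_pos_left _ hm
  have hlt : (List.range (m * Z)).findIdx (fun i => decide (GridTest m Z (Z + 1 + i))) <
      (List.range (m * Z)).length := by
    refine List.findIdx_lt_length_of_exists ⟨m * Z - 1, List.mem_range.2 (by omega), ?_⟩
    rw [decide_eq_true_eq]
    convert gridTest_mul (m := m) hZ using 1
    rw [add_mul]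
    omega
  have hget := List.findIdx_getElem (w := hlt)
  rw [List.getElem_range, decide_eq_true_eq] at hget
  rw [firstRatio]
  convert hget

theorem firstRatio_gt (m Z : ℕ) : Z < firstRatio m Z := by
  rw [firstRatio]; omega

/-- Either the predecessor `k - 1` was rejected, and rejection proves that its ratio is unsafe for
some speeds, or `k - 1 = Z` and the trivial bound `1` applies. -/
theorem frac_firstRatio_le {Z : ℕ} (hZ : 1 ≤ Z) :
    (frac (firstRatio m Z - 1, Z) : ℝ≥0∞) ≤ optimalRatio m := by
  classical
  by_cases h : firstRatio m Z = Z + 1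
  · refine le_trans ?_ one_le_optimalRatio
    rw [h, Nat.add_sub_cancel, frac, div_self (by positivity)]
    exact le_rfl
  · have hgt := firstRatio_gt m Z
    obtain ⟨q, hq, hn⟩ := exists_not_safe_of_not_gridTest (m := m) (k := firstRatio m Z - 1) hZ
      (by omega) (by
        obtain ⟨n, hn⟩ : ∃ n, firstRatio m Z = Z + 1 + (n + 1) :=
          ⟨firstRatio m Z - Z - 2, by omega⟩
        have hn' : n < (List.range (m * Z)).findIdx
            (fun i => decide (GridTest m Z (Z + 1 + i))) := by
          have : firstRatio m Z = Z + 1 + (List.range (m * Z)).findIdx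
            (fun i => decide (GridTest m Z (Z + 1 + i))) := by rw [firstRatio]
          omega
        have := List.not_of_lt_findIdx hn'
        rw [List.getElem_range, decide_eq_false_iff_not] at this
        convert this using 2
        omega)
    exact le_optimalRatio hq hn

end Spec

/-! ### Assembly of the scheme. -/

/-- The approximation scheme, built from a code for the program. -/
noncomputable def schemeOf (c : Nat.Partrec.Code) (x : ℕ × (ℕ × ℕ)) :
    Nat.Partrec.Code × ℕ × (ℕ × ℕ) :=
  (c.curry (Encodable.encode (100 * x.2.2, firstRatio x.1 (100 * x.2.2))), 100 * x.2.2,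
    (firstRatio x.1 (100 * x.2.2) - 1, 100 * x.2.2))

theorem computable_schemeOf (c : Nat.Partrec.Code) : Computable (schemeOf c) := by
  have hZ : Primrec fun x : ℕ × (ℕ × ℕ) => 100 * x.2.2 :=
    Primrec.nat_mul.comp (.const 100) (Primrec.snd.comp .snd)
  have hk : Primrec fun x : ℕ × (ℕ × ℕ) => firstRatio x.1 (100 * x.2.2) :=
    primrec_firstRatio .fst hZ
  exact (Primrec.pair (Nat.Partrec.Code.primrec₂_curry.comp (.const c)
    (Primrec.encode.comp (hZ.pair hk))) (hZ.pair
      ((Primrec.nat_sub.comp hk (.const 1)).pair hZ))).to_comp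

/-- The five factors come from the grid (two), truncation, the growth of the program's ratio, and
the rounding of the speeds. Replacing `k` by `k - 1` costs a sixth, and `(1 + y) ^ 6 ≤ 1 + 100 * y`
with `100 * y = 1 / b`. -/
theorem loss_le {a b : ℕ} (ha : 1 ≤ a) (hb : 1 ≤ b) {k : ℕ} (hk : 100 * b < k) :
    (1 + 1 / ((100 * b : ℕ) : ℝ)) ^ 5 * (k / (100 * b : ℕ)) ≤
      (1 + frac (a, b)) * frac (k - 1, 100 * b) := by
  have hb' : (1 : ℝ) ≤ b := by exact_mod_cast hb
  have ha' : (1 : ℝ) ≤ a := by exact_mod_cast ha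
  obtain ⟨n, rfl⟩ : ∃ n, k = n + 1 := ⟨k - 1, by omega⟩
  have hn : 100 * (b : ℝ) ≤ n := by exact_mod_cast Nat.lt_succ_iff.1 hk
  rw [coe_frac, coe_frac, Nat.add_sub_cancel]
  dsimp only
  push_cast
  set y : ℝ := 1 / (100 * b) with hy
  have hy0 : 0 < y := by positivity
  have hy1 : y ≤ 1 := by rw [hy, div_le_one (by positivity)]; linarith
  have h1 : ((n : ℝ) + 1) / (100 * b) ≤ (1 + y) * (n / (100 * b)) := by
    rw [hy, ← mul_div_assoc]
    gcongr
    have : (1 : ℝ) ≤ 1 / (100 * b) * n := by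
      rw [one_div_mul_eq_div, one_le_div (by positivity)]; exact hn
    linarith
  have h2 : (1 + y) ^ 6 ≤ 1 + a / b := by
    have h3 : (1 + y) ^ 2 ≤ 1 + 3 * y := by nlinarith
    have h4 : (1 + y) ^ 6 ≤ (1 + 3 * y) ^ 3 := by
      calc (1 + y) ^ 6 = ((1 + y) ^ 2) ^ 3 := by ring
        _ ≤ _ := by gcongr
    have h5 : (1 + 3 * y) ^ 3 ≤ 1 + 100 * y := by
      have : y ^ 2 ≤ y := by nlinarith
      have : y ^ 3 ≤ y := by nlinarith [pow_pos hy0 2]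
      nlinarith
    have h6 : 100 * y ≤ a / b := by
      rw [hy, mul_one_div, div_le_div_iff₀ (by positivity) (by positivity)]
      nlinarith
    linarith
  calc (1 + y) ^ 5 * ((n + 1) / (100 * b)) ≤ (1 + y) ^ 5 * ((1 + y) * (n / (100 * b))) := by
        gcongr
    _ = (1 + y) ^ 6 * (n / (100 * b)) := by ring
    _ ≤ _ := by gcongr

end RelatedMachines

theorem mainTheorem2 :
    ∃ scheme : ℕ × (ℕ × ℕ) → Nat.Partrec.Code × ℕ × (ℕ × ℕ),
      Computable scheme ∧
      ∀ (m a b : ℕ), 1 ≤ m → 1 ≤ a → 1 ≤ b →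
        ∀ (c : Nat.Partrec.Code) (d : ℕ) (r : ℕ × ℕ), scheme (m, (a, b)) = (c, d, r) →
          (∀ (q : Fin m → ℕ × ℕ) (l : List ℕ), (∀ i, 0 < RelatedMachines.frac (q i)) →
            ∃ i : Fin m, RelatedMachines.Outputs c q l i) ∧
          (∀ A : RelatedMachines.OnlineAlg m, RelatedMachines.Executes c d A →
            A.competitiveRatio ≤
              (1 + (RelatedMachines.frac (a, b) : ENNReal)) * RelatedMachines.optimalRatio m) ∧
          (RelatedMachines.frac r : ENNReal) ≤ RelatedMachines.optimalRatio m ∧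
          RelatedMachines.optimalRatio m ≤
            (1 + (RelatedMachines.frac (a, b) : ENNReal)) * (RelatedMachines.frac r : ENNReal) := by
  open RelatedMachines in
  obtain ⟨c₀, hc₀⟩ := exists_runCode
  refine ⟨schemeOf c₀, computable_schemeOf c₀, ?_⟩
  rintro m a b hm ha hb c d r ⟨rfl, rfl, rfl⟩
  have : NeZero m := ⟨by omega⟩
  have hZ : 1 ≤ 100 * b := by omega
  have hk := firstRatio_gt m (100 * b)
  have hlow := frac_firstRatio_le (m := m) hZ
  have hloss := loss_le ha hb hk
  have hsafe := fun (s : Fin m → ℝ) (hs : ∀ i, 0 < s i) =>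
    safe_of_gridTest hZ hk.le (gridTest_firstRatio hZ) hs
  dsimp only
  set Z := 100 * b
  set k := firstRatio m Z
  have hZ' : (0 : ℝ) < Z := by exact_mod_cast hZ
  have hbase : (1 : ℝ) ≤ 1 + 1 / Z := le_add_of_nonneg_right (by positivity)
  refine ⟨fun q l _ => ⟨⟨(run ((Z, k), List.ofFn q) l).2.2, ?_⟩, ?_⟩, fun A hA => ?_, hlow, ?_⟩
  · have := run_lt (x := ((Z, k), List.ofFn q)) (by simpa using NeZero.pos m) l
    simpa using this
  · rw [Outputs, hc₀]
    exact Part.mem_some _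
  · let R : ℝ≥0 := (1 + 1 / Z) ^ 4 * (k / Z)
    have hR : (R : ℝ) = (1 + 1 / Z) ^ 4 * (k / Z) := by simp [R]
    have hρ : R * (1 + 2⁻¹ ^ Z) ≤ (1 + frac (a, b)) * frac (k - 1, Z) := by
      rw [← NNReal.coe_le_coe]
      push_cast
      refine le_trans ?_ hloss
      rw [hR]
      -- The scheme outputs the precision `d = Z`, so approximating the speeds costs at most one
      -- more factor `1 + 1 / Z`.
      have h1 : (2 : ℝ)⁻¹ ^ Z ≤ 1 / Z := by
        rw [inv_pow, ← one_div]
        have : (Z : ℝ) ≤ 2 ^ Z := by exact_mod_cast Nat.lt_two_pow_self.le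
        gcongr
      calc (1 + 1 / (Z : ℝ)) ^ 4 * (k / Z) * (1 + 2⁻¹ ^ Z)
          ≤ (1 + 1 / (Z : ℝ)) ^ 4 * (k / Z) * (1 + 1 / Z) := by gcongr
        _ = _ := by ring
    refine (competitiveRatio_le hρ fun s hs => ?_).trans ?_
    · obtain ⟨q, hq, hout⟩ := hA s hs
      refine ⟨fun i => (frac (q i) : ℝ), fun i => by exact_mod_cast (hq i).1,
        fun i => (hq i).2.1, fun i => by simpa using (hq i).2.2, fun l hl i => ?_⟩
      rw [hR]
      refine stratLoad_run_le (fun i => (hq i).1) hZ hk.le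
        (hsafe _ fun i => by exact_mod_cast (hq i).1) (fun l => ?_) hl i
      have := hout l
      rw [Outputs, hc₀] at this
      exact Part.mem_some_iff.1 this
    · push_cast
      gcongr
  · let R : ℝ≥0 := (1 + 1 / Z) ^ 3 * (k / Z)
    have hR : (R : ℝ) = (1 + 1 / Z) ^ 3 * (k / Z) := by simp [R]
    refine (optimalRatio_le (r := R) fun s hs => by rw [hR]; exact hsafe s hs).trans ?_
    have : R ≤ (1 + frac (a, b)) * frac (k - 1, Z) := by
      rw [← NNReal.coe_le_coe]
      push_cast
      refine le_trans ?_ hloss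
      rw [hR]
      gcongr
      norm_num
    exact_mod_cast this
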